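/- Let $M$, $B$ and $F$ be closed (compact, Hausdorff, boundaryless) $C^\infty$ manifolds with $M$ connected and $\dim B>0$, $\dim F>0$, and let $\pi\colon M\to B$ be a $C^\infty$ fiber bundle with fiber $F$, i.e. $\pi$ is locally diffeomorphic, over $B$, to the projection $U\times F\to U$. All Riemannian metrics are $C^\infty$, and with respect to such a metric, for a linear map $A$ between normed spaces, $\|A\|$ is the operator norm and $m(A)=\inf_{\|v\|=1}\|Av\|$ is the conorm (equal to $\infty$ on the zero space). A diffeomorphism $h$ of class $C^1$ of a closed manifold $N$ is *Anosov* with splitting $TN=E^s_h\oplus E^u_h$ if $E^s_h,E^u_h$ are continuous $Dh$-invariant subbundles and there are a Riemannian metric and constants $0<\nu<1<\mu$ with $\|D_xh|_{E^s_h(x)}\|<\nu$ and $m(D_xh|_{E^u_h(x)})>\mu$ for all $x\in N$. It is *partially hyperbolic* with splitting $TN=E^s_h\oplus E^c_h\oplus E^u_h$ if $E^s_h,E^c_h,E^u_h$ are nonzero continuous $Dh$-invariant subbundles and there are a Riemannian metric and constants $0<\nu<1<\mu$ such that for all $x\in N$ $$\|D_xh|_{E^s_h(x)}\|<\nu<m(D_xh|_{E^c_h(x)})\le\|D_xh|_{E^c_h(x)}\|<\mu<m(D_xh|_{E^u_h(x)}).$$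 Let $f\colon M\to M$ be a $C^\infty$ diffeomorphism, let $\bar f\colon B\to B$ be an Anosov diffeomorphism with $\pi\circ f=\bar f\circ\pi$ and splitting $TB=E^s_{\bar f}\oplus E^u_{\bar f}$, and let $\lambda>1$. Suppose that 1. there is a Riemannian metric on $M$ such that the distortion of $f$ along the fibers, $$D(f)=\sup_{p\in M}\max\left\{\|D_pf|_{\ker D_p\pi}\|,\ \|D_pf^{-1}|_{\ker D_p\pi}\|\right\},$$ satisfies $D(f)<\lambda$; and 2. there is a Riemannian metric on $B$ such that for all $x\in B$, $\|D_x\bar f|_{E^s_{\bar f}(x)}\|<\lambda^{-1}$ and $m(D_x\bar f|_{E^u_{\bar f}(x)})>\lambda$. Then $f$ is partially hyperbolic with a splitting $TM=E^s_f\oplus E^c_f\oplus E^u_f$ such that $E^c_f(p)=\ker D_p\pi$ for all $p\in M$, and there is a $C^\infty$ Riemannian metric on $M$ such that for all $p\in M$ $$\|D_pf|_{E^s_f(p)}\|<\lambda^{-1}<m(D_pf|_{E^c_f(p)})\le\|D_pf|_{E^c_f(p)}\|<\lambda<m(D_pf|_{E^u_f(p)}).$$ -/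

import Mathlib

open scoped Manifold ContDiff ENNReal Topology

noncomputable section

/-- A smooth Riemannian metric on a smooth manifold without boundary of dimension `n`. -/
abbrev SmoothMetric (n : ℕ) (M : Type*) [TopologicalSpace M]
    [ChartedSpace (EuclideanSpace ℝ (Fin n)) M] [IsManifold (𝓡 n) ∞ M] : Type _ :=
  Bundle.ContMDiffRiemannianMetric (𝓡 n) ∞ (EuclideanSpace ℝ (Fin n))
    (fun x : M => TangentSpace (𝓡 n) x)

/-- A field of linear subspaces of the tangent spaces of a manifold. -/
abbrev PlaneField (n : ℕ) (M : Type*) [TopologicalSpace M]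
    [ChartedSpace (EuclideanSpace ℝ (Fin n)) M] : Type _ :=
  ∀ x : M, Submodule ℝ (TangentSpace (𝓡 n) x)

section Manifolds

variable {n : ℕ} {M : Type*} [TopologicalSpace M] [ChartedSpace (EuclideanSpace ℝ (Fin n)) M]

/-- A field of subspaces is a continuous subbundle of the tangent bundle if near every point it has
a frame consisting of continuous vector fields. -/
def IsContinuousSubbundle [IsManifold (𝓡 n) 1 M] (E : PlaneField n M) : Prop :=
  ∀ x₀ : M, ∃ (r : ℕ) (U : Set M) (s : Fin r → ∀ x : M, TangentSpace (𝓡 n) x),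
    IsOpen U ∧ x₀ ∈ U ∧
    (∀ i, ContinuousOn (fun x => (⟨x, s i x⟩ : TangentBundle (𝓡 n) M)) U) ∧
    ∀ x ∈ U, LinearIndependent ℝ (fun i => s i x) ∧
      Submodule.span ℝ (Set.range fun i => s i x) = E x

/-- The field of subspaces `E` is invariant under the derivative of `f`:
`D_x f (E(x)) = E(f(x))` for every `x`. -/
def IsDInvariant (f : M → M) (E : PlaneField n M) : Prop :=
  ∀ x : M, (E x).map (mfderiv (𝓡 n) (𝓡 n) f x).toLinearMap = E (f x)

variable [IsManifold (𝓡 n) ∞ M]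

/-- The length of a tangent vector with respect to the metric `g`. -/
def SmoothMetric.length (g : SmoothMetric n M) (x : M) (v : TangentSpace (𝓡 n) x) : ℝ :=
  √(g.inner x v v)

/-- The operator norm `‖D_x f|_{E(x)}‖` with respect to the metric `g`: the supremum of the lengths
of `D_x f v` over the unit vectors `v` in `E(x)` (it is `0` if `E(x) = 0`). -/
def normOn (g : SmoothMetric n M) (f : M → M) (E : PlaneField n M) (x : M) : ℝ≥0∞ :=
  ⨆ v : {v : TangentSpace (𝓡 n) x // v ∈ E x ∧ g.length x v = 1},
    ENNReal.ofReal (g.length (f x) (mfderiv (𝓡 n) (𝓡 n) f x v.1))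

/-- The conorm `m(D_x f|_{E(x)})` with respect to the metric `g`: the infimum of the lengths
of `D_x f v` over the unit vectors `v` in `E(x)` (it is `∞` if `E(x) = 0`). -/
def conormOn (g : SmoothMetric n M) (f : M → M) (E : PlaneField n M) (x : M) : ℝ≥0∞ :=
  ⨅ v : {v : TangentSpace (𝓡 n) x // v ∈ E x ∧ g.length x v = 1},
    ENNReal.ofReal (g.length (f x) (mfderiv (𝓡 n) (𝓡 n) f x v.1))

/-- The data of an Anosov splitting `TM = Es ⊕ Eu` of the diffeomorphism `f`: the two summands are
continuous `Df`-invariant subbundles and, in some smooth metric, `Df` contracts `Es` and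
expands `Eu` by constants. -/
structure IsAnosovSplitting {k : ℕ∞ω} (f : M ≃ₘ^k⟮𝓡 n, 𝓡 n⟯ M) (Es Eu : PlaneField n M) :
    Prop where
  regularity : 1 ≤ k
  continuous_s : IsContinuousSubbundle Es
  continuous_u : IsContinuousSubbundle Eu
  isCompl : ∀ x, IsCompl (Es x) (Eu x)
  invariant_s : IsDInvariant f Es
  invariant_u : IsDInvariant f Eu
  bounds : ∃ (g : SmoothMetric n M) (ν μ : ℝ), 0 < ν ∧ ν < 1 ∧ 1 < μ ∧
    ∀ x, normOn g f Es x < ENNReal.ofReal ν ∧ ENNReal.ofReal μ < conormOn g f Eu x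

/-- The chain of inequalities
`‖D_x f|Es‖ < ν < m(D_x f|Ec) ≤ ‖D_x f|Ec‖ < μ < m(D_x f|Eu)` at every point `x`, with norms and
conorms taken in the metric `g`. -/
def PartiallyHyperbolicBounds (g : SmoothMetric n M) (f : M → M) (Es Ec Eu : PlaneField n M)
    (ν μ : ℝ) : Prop :=
  ∀ x, normOn g f Es x < ENNReal.ofReal ν ∧
    ENNReal.ofReal ν < conormOn g f Ec x ∧
    conormOn g f Ec x ≤ normOn g f Ec x ∧
    normOn g f Ec x < ENNReal.ofReal μ ∧
    ENNReal.ofReal μ < conormOn g f Eu x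

/-- The data of an (absolutely) partially hyperbolic splitting `TM = Es ⊕ Ec ⊕ Eu` of the
diffeomorphism `f`: the three summands are nonzero continuous `Df`-invariant subbundles, and the
bounds of partial hyperbolicity hold in some smooth metric with uniform constants
`0 < ν < 1 < μ`. -/
structure IsPartiallyHyperbolicSplitting {k : ℕ∞ω} (f : M ≃ₘ^k⟮𝓡 n, 𝓡 n⟯ M)
    (Es Ec Eu : PlaneField n M) : Prop where
  regularity : 1 ≤ k
  continuous_s : IsContinuousSubbundle Es
  continuous_c : IsContinuousSubbundle Ec
  continuous_u : IsContinuousSubbundle Eu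
  nontrivial : ∀ x, Es x ≠ ⊥ ∧ Ec x ≠ ⊥ ∧ Eu x ≠ ⊥
  isInternal : ∀ x, DirectSum.IsInternal ![Es x, Ec x, Eu x]
  invariant_s : IsDInvariant f Es
  invariant_c : IsDInvariant f Ec
  invariant_u : IsDInvariant f Eu
  bounds : ∃ (g : SmoothMetric n M) (ν μ : ℝ), 0 < ν ∧ ν < 1 ∧ 1 < μ ∧
    PartiallyHyperbolicBounds g f Es Ec Eu ν μ

end Manifolds

section Bundles

variable {m b d : ℕ}
  {M : Type*} [TopologicalSpace M] [ChartedSpace (EuclideanSpace ℝ (Fin m)) M]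
  {B : Type*} [TopologicalSpace B] [ChartedSpace (EuclideanSpace ℝ (Fin b)) B]

/-- `π : M → B` is a smooth fiber bundle with fiber `F`: every point of `B` lies in an open set `U`
with a diffeomorphism of `π ⁻¹(U)` onto `U × F` that commutes with the projections to `U`. -/
def IsSmoothFiberBundle (d : ℕ) (F : Type*) [TopologicalSpace F]
    [ChartedSpace (EuclideanSpace ℝ (Fin d)) F] (π : M → B) : Prop :=
  ∀ x : B, ∃ e : Bundle.Trivialization F π, x ∈ e.baseSet ∧
    ContMDiffOn (𝓡 m) ((𝓡 b).prod (𝓡 d)) ∞ e e.source ∧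
    ContMDiffOn ((𝓡 b).prod (𝓡 d)) (𝓡 m) ∞ e.toOpenPartialHomeomorph.symm e.target

/-- The vertical distribution `ker Dπ`, that is, the tangent spaces of the fibers of `π`. -/
def verticalField (π : M → B) : PlaneField m M :=
  fun p => LinearMap.ker (mfderiv (𝓡 m) (𝓡 b) π p).toLinearMap

/-- The distortion `D(f)` of `f` along the fibers of `π` with respect to the metric `g`: the
supremum over all points of the norms of the derivatives of `f` and of its inverse along
the fibers. -/
def fiberDistortion [IsManifold (𝓡 m) ∞ M] {k : ℕ∞ω} (g : SmoothMetric m M) (π : M → B)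
    (f : M ≃ₘ^k⟮𝓡 m, 𝓡 m⟯ M) : ℝ≥0∞ :=
  ⨆ p : M, max (normOn g f (verticalField (b := b) π) p)
    (normOn g f.symm (verticalField (b := b) π) p)

end Bundles

end

/-! The stable bundle of `f` is the unique lift of the stable bundle `EsB` of `fbar` that decays as
fast as its projection. By compactness `fbar` contracts `EsB` at a uniform rate `c < l⁻¹`, while
along the fibers `|w| ≤ δ |Df w|` with `δ < l`, so `δ * c < 1`. Let `contractingField` consist of
the vectors over `EsB` whose forward orbits are `O(c ^ k)`.

Uniqueness: two such vectors with the same projection differ by a vertical vector `w` with `|w| ≤ δ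
^ k |Df^k w| ≤ C (δ c) ^ k`, which tends to `0` (`eq_zero_of_mem_contractingField`).

Existence: there is a constant `K` such that `|Df w| ≤ K |Dfbar v|` implies `|w| ≤ K |v|` whenever
`w` lies over `v` in `EsB` (`exists_length_le_of_tangentMap`). Hence the lifts of `v` that satisfy
the bound at time `k` form decreasing nonempty compact sets, and a common point satisfies it at all
times (`exists_lift`).

Continuity: the bound with this fixed `K` is a closed condition, so limits of lifts are lifts, and
uniqueness identifies them (`isContinuousSubbundle_contractingField`). The unstable bundle is
obtained from the same statements for `f.symm`.

The bundles are only continuous, so a smooth metric cannot in general be built directly from the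
splitting. Instead take `gM + T • π^* gB`: it does not change vertical lengths, and for large `T`
the rates on the lifted bundles approach those on `B` (`exists_length_addPullback_le`).

The lifted bundles are nonzero because those of `fbar` are: if one vanished, `fbar` or its inverse
would contract the connected compact manifold `B` uniformly, which is impossible for a surjection
(`not_uniform_contraction`). -/

noncomputable section
open Filter Bundle Set

/-! ### Lengths of tangent vectors and compactness of disc bundles -/

section Length

variable {n : ℕ} {M : Type*} [TopologicalSpace M] [ChartedSpace (EuclideanSpace ℝ (Fin n)) M]
  [IsManifold (𝓡 n) ∞ M] (g : SmoothMetric n M)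

namespace SmoothMetric

theorem length_eq_norm (x : M) (v : TangentSpace (𝓡 n) x) :
    letI : RiemannianBundle (fun x : M => TangentSpace (𝓡 n) x) := ⟨g.toRiemannianMetric⟩
    g.length x v = ‖v‖ := by
  let : RiemannianBundle (fun x : M => TangentSpace (𝓡 n) x) := ⟨g.toRiemannianMetric⟩
  rw [@norm_eq_sqrt_real_inner]
  rfl

theorem length_nonneg (x : M) (v : TangentSpace (𝓡 n) x) : 0 ≤ g.length x v := Real.sqrt_nonneg _

theorem sq_length (x : M) (v : TangentSpace (𝓡 n) x) : g.length x v ^ 2 = g.inner x v v := by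
  refine Real.sq_sqrt ?_
  rcases eq_or_ne v 0 with rfl | hv
  · simp
  · exact (g.pos x v hv).le

theorem length_add_le (x : M) (v w : TangentSpace (𝓡 n) x) :
    g.length x (v + w) ≤ g.length x v + g.length x w := by
  let : RiemannianBundle (fun x : M => TangentSpace (𝓡 n) x) := ⟨g.toRiemannianMetric⟩
  simp only [length_eq_norm]
  exact norm_add_le v w

theorem length_sub_le (x : M) (v w : TangentSpace (𝓡 n) x) :
    g.length x (v - w) ≤ g.length x v + g.length x w := by
  let : RiemannianBundle (fun x : M => TangentSpace (𝓡 n) x) := ⟨g.toRiemannianMetric⟩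
  simp only [length_eq_norm]
  exact norm_sub_le v w

theorem length_smul (x : M) (a : ℝ) (v : TangentSpace (𝓡 n) x) :
    g.length x (a • v) = |a| * g.length x v := by
  let : RiemannianBundle (fun x : M => TangentSpace (𝓡 n) x) := ⟨g.toRiemannianMetric⟩
  simp only [length_eq_norm]
  rw [norm_smul, Real.norm_eq_abs]

@[simp] theorem length_zero (x : M) : g.length x 0 = 0 := by
  simp [length]

theorem length_eq_zero {x : M} {v : TangentSpace (𝓡 n) x} : g.length x v = 0 ↔ v = 0 := by
  let : RiemannianBundle (fun x : M => TangentSpace (𝓡 n) x) := ⟨g.toRiemannianMetric⟩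
  simp only [length_eq_norm]
  exact norm_eq_zero

theorem length_pos {x : M} {v : TangentSpace (𝓡 n) x} (hv : v ≠ 0) : 0 < g.length x v :=
  (g.length_nonneg x v).lt_of_ne fun h => hv (g.length_eq_zero.1 h.symm)

theorem continuous_length :
    Continuous fun w : TangentBundle (𝓡 n) M => g.length w.1 w.2 := by
  let : RiemannianBundle (fun x : M => TangentSpace (𝓡 n) x) := ⟨g.toRiemannianMetric⟩
  have : IsContinuousRiemannianBundle (EuclideanSpace ℝ (Fin n))
      (fun x : M => TangentSpace (𝓡 n) x) := ⟨g.inner, g.contMDiff.continuous, fun _ _ _ => rfl⟩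
  have h : Continuous fun w : TangentBundle (𝓡 n) M => @inner ℝ (TangentSpace (𝓡 n) w.1) _ w.2 w.2 :=
    Continuous.inner_bundle (F := EuclideanSpace ℝ (Fin n))
      (E := fun x : M => TangentSpace (𝓡 n) x) (b := fun w : TangentBundle (𝓡 n) M => w.1)
      (v := fun w => w.2) (w := fun w => w.2) continuous_id continuous_id
  exact h.sqrt

/-- Near every point the coordinates of a tangent vector are bounded by its length. -/
theorem exists_norm_trivializationAt_le (x₀ : M) :
    ∃ C > 0, ∀ᶠ x in 𝓝 x₀, ∀ v : TangentSpace (𝓡 n) x,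
      ‖(trivializationAt (EuclideanSpace ℝ (Fin n)) (TangentSpace (𝓡 n)) x₀).continuousLinearMapAt
        ℝ x v‖ ≤ C * g.length x v := by
  let : RiemannianBundle (fun x : M => TangentSpace (𝓡 n) x) := ⟨g.toRiemannianMetric⟩
  have : IsContinuousRiemannianBundle (EuclideanSpace ℝ (Fin n))
      (fun x : M => TangentSpace (𝓡 n) x) := ⟨g.inner, g.contMDiff.continuous, fun _ _ _ => rfl⟩
  obtain ⟨C, hC, h⟩ := eventually_norm_trivializationAt_lt (EuclideanSpace ℝ (Fin n))
    (fun x : M => TangentSpace (𝓡 n) x) x₀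
  refine ⟨C, hC, h.mono fun x hx v => ?_⟩
  rw [length_eq_norm]
  exact ContinuousLinearMap.le_of_opNorm_le _ hx.le v

/-- Near every point the length of a tangent vector is bounded by its coordinates. -/
theorem exists_length_symmL_le (x₀ : M) :
    ∃ C > 0, ∀ᶠ x in 𝓝 x₀, ∀ a : EuclideanSpace ℝ (Fin n),
      g.length x ((trivializationAt (EuclideanSpace ℝ (Fin n))
        (TangentSpace (𝓡 n)) x₀).symmL ℝ x a) ≤ C * ‖a‖ := by
  let : RiemannianBundle (fun x : M => TangentSpace (𝓡 n) x) := ⟨g.toRiemannianMetric⟩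
  have : IsContinuousRiemannianBundle (EuclideanSpace ℝ (Fin n))
      (fun x : M => TangentSpace (𝓡 n) x) := ⟨g.inner, g.contMDiff.continuous, fun _ _ _ => rfl⟩
  obtain ⟨C, hC, h⟩ := eventually_norm_symmL_trivializationAt_lt (EuclideanSpace ℝ (Fin n))
    (fun x : M => TangentSpace (𝓡 n) x) x₀
  refine ⟨C, hC, h.mono fun x hx v => ?_⟩
  rw [length_eq_norm]
  exact ContinuousLinearMap.le_of_opNorm_le _ hx.le v

/-- The disc bundles of a compact Riemannian manifold are compact. -/
theorem isCompact_length_le [CompactSpace M] (R : ℝ) :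
    IsCompact {w : TangentBundle (𝓡 n) M | g.length w.1 w.2 ≤ R} := by
  rw [isCompact_iff_ultrafilter_le_nhds]
  intro u hu
  -- Base points converge by compactness of `M`. Near the limit the fiber coordinates stay in a
  -- fixed closed ball, so they converge too, and the trivialization reassembles the two limits.
  obtain ⟨x₀, -, hx₀⟩ := isCompact_univ.ultrafilter_le_nhds (u.map TotalSpace.proj)
    (by simp)
  have hx₀ : Tendsto (TotalSpace.proj : TangentBundle (𝓡 n) M → M) u (𝓝 x₀) := hx₀
  set e := trivializationAt (EuclideanSpace ℝ (Fin n)) (TangentSpace (𝓡 n)) x₀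
  obtain ⟨C, hC, h⟩ := g.exists_norm_trivializationAt_le x₀
  have hbase : e.baseSet ∈ 𝓝 x₀ :=
    e.open_baseSet.mem_nhds (FiberBundle.mem_baseSet_trivializationAt' x₀)
  have hball : ∀ᶠ w : TangentBundle (𝓡 n) M in u, (e w).2 ∈ Metric.closedBall 0 (C * R) := by
    filter_upwards [hx₀.eventually h, hx₀.eventually hbase, le_principal_iff.1 hu] with w h1 h2 h3
    rw [mem_closedBall_zero_iff]
    refine le_trans ?_ ((h1 w.2).trans (mul_le_mul_of_nonneg_left h3 hC.le))
    rw [Trivialization.continuousLinearMapAt_apply, Trivialization.coe_linearMapAt_of_mem _ h2]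
  obtain ⟨a, -, ha⟩ := (isCompact_closedBall (0 : EuclideanSpace ℝ (Fin n)) (C * R)).ultrafilter_le_nhds
    (u.map fun w => (e w).2) (le_principal_iff.2 hball)
  have ha : Tendsto (fun w : TangentBundle (𝓡 n) M => (e w).2) u (𝓝 a) := ha
  have hmem : (x₀, a) ∈ e.target := by
    rw [e.mem_target]; exact FiberBundle.mem_baseSet_trivializationAt' x₀
  have hlim : Tendsto (fun w : TangentBundle (𝓡 n) M => e.toOpenPartialHomeomorph.symm (w.1, (e w).2))
      u (𝓝 (e.toOpenPartialHomeomorph.symm (x₀, a))) :=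
    (e.toOpenPartialHomeomorph.continuousAt_symm hmem).tendsto.comp (hx₀.prodMk_nhds ha)
  have hlim' : Tendsto id (u : Filter (TangentBundle (𝓡 n) M))
      (𝓝 (e.toOpenPartialHomeomorph.symm (x₀, a))) := by
    refine hlim.congr' ?_
    filter_upwards [hx₀.eventually hbase] with w hw
    have hs : w ∈ e.source := e.mem_source.2 hw
    have : (w.1, (e w).2) = e w := (e.mk_proj_snd hs)
    rw [this]
    exact e.toOpenPartialHomeomorph.left_inv hs
  refine ⟨_, ?_, hlim'⟩
  exact le_of_tendsto ((g.continuous_length.tendsto _).comp hlim') (le_principal_iff.1 hu)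

end SmoothMetric

end Length
end

/-! ### Continuous right inverses and derivatives in trivializations -/

noncomputable section
open Filter Bundle Set

/-- A continuous family of linear maps has a continuous family of right inverses near every
parameter at which it is surjective. -/
theorem exists_continuousOn_rightInverse {X E G : Type*} [TopologicalSpace X]
    [NormedAddCommGroup E] [NormedSpace ℝ E] [NormedAddCommGroup G] [NormedSpace ℝ G]
    [FiniteDimensional ℝ G] {A : X → E →L[ℝ] G} {U : Set X} (hU : IsOpen U)
    (hA : ContinuousOn A U) {x₀ : X} (hx₀ : x₀ ∈ U) (hsurj : Function.Surjective (A x₀)) :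
    ∃ (V : Set X) (R : X → G →L[ℝ] E), IsOpen V ∧ x₀ ∈ V ∧ V ⊆ U ∧ ContinuousOn R V ∧
      (∀ x ∈ V, ∀ a, A x (R x a) = a) ∧
      ∀ x ∈ V, ∀ a, R x a ∈ LinearMap.range (R x₀).toLinearMap := by
  have : CompleteSpace G := FiniteDimensional.complete ℝ G
  obtain ⟨S, hS⟩ := (A x₀).toLinearMap.exists_rightInverse_of_surjective
    (LinearMap.range_eq_top.2 hsurj)
  let R₀ : G →L[ℝ] E := LinearMap.toContinuousLinearMap S
  have hR₀ : ∀ a, A x₀ (R₀ a) = a := fun a => LinearMap.congr_fun hS a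
  -- Fix a right inverse `R₀` at `x₀` and correct it by `(A x ∘ R₀)⁻¹` on the open set where this
  -- exists. Correcting on the right keeps every range inside that of `R₀`.
  let Q : X → G →L[ℝ] G := fun x => (A x).comp R₀
  have hQ : ContinuousOn Q U := hA.clm_comp continuousOn_const
  have hQ₀ : Q x₀ = 1 := by ext a; exact hR₀ a
  have hV : IsOpen (U ∩ Q ⁻¹' {T | IsUnit T}) := hQ.isOpen_inter_preimage hU Units.isOpen
  refine ⟨_, fun x => R₀.comp (Ring.inverse (Q x)), hV, ⟨hx₀, ?_⟩, inter_subset_left, ?_, ?_, ?_⟩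
  · simp [hQ₀]
  · refine ContinuousOn.clm_comp continuousOn_const ?_
    rintro x ⟨hxU, u, hu⟩
    have h1 : ContinuousAt Ring.inverse (Q x) := by
      rw [← hu]; exact NormedRing.inverse_continuousAt u
    exact h1.comp_continuousWithinAt ((hQ x hxU).mono inter_subset_left)
  · rintro x ⟨hxU, hx⟩ a
    have := Ring.mul_inverse_cancel (Q x) hx
    exact DFunLike.congr_fun this a
  · rintro x - a
    simp only [hQ₀, Ring.inverse_one]
    exact ⟨Ring.inverse (Q x) a, rfl⟩

section Coordinates

variable {m b : ℕ}
  {M : Type*} [TopologicalSpace M] [ChartedSpace (EuclideanSpace ℝ (Fin m)) M]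
  [IsManifold (𝓡 m) ∞ M]
  {B : Type*} [TopologicalSpace B] [ChartedSpace (EuclideanSpace ℝ (Fin b)) B]
  [IsManifold (𝓡 b) ∞ B]

/-- The trivialization of the tangent bundle given by the preferred chart at `x₀`. -/
abbrev tangentTriv (m : ℕ) {M : Type*} [TopologicalSpace M]
    [ChartedSpace (EuclideanSpace ℝ (Fin m)) M] [IsManifold (𝓡 m) ∞ M] (x₀ : M) : Trivialization (EuclideanSpace ℝ (Fin m))
    (TotalSpace.proj : TangentBundle (𝓡 m) M → M) :=
  trivializationAt (EuclideanSpace ℝ (Fin m)) (TangentSpace (𝓡 m)) x₀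

theorem tangentTriv_baseSet_mem_nhds (x₀ : M) : (tangentTriv m x₀).baseSet ∈ 𝓝 x₀ :=
  (tangentTriv m x₀).open_baseSet.mem_nhds (FiberBundle.mem_baseSet_trivializationAt' x₀)

theorem mem_tangentTriv_baseSet (x₀ : M) : x₀ ∈ (tangentTriv m x₀).baseSet :=
  FiberBundle.mem_baseSet_trivializationAt' x₀

theorem mk_tangentTriv_symmL {x₀ x : M} (hx : x ∈ (tangentTriv m x₀).baseSet)
    (a : EuclideanSpace ℝ (Fin m)) :
    (⟨x, (tangentTriv m x₀).symmL ℝ x a⟩ : TangentBundle (𝓡 m) M) =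
      (tangentTriv m x₀).toOpenPartialHomeomorph.symm (x, a) := by
  rw [Trivialization.symmL_apply _ hx]
  exact (tangentTriv m x₀).mk_symm hx a

theorem continuousLinearMapAt_tangentTriv {x₀ x : M} (hx : x ∈ (tangentTriv m x₀).baseSet)
    (v : TangentSpace (𝓡 m) x) :
    (tangentTriv m x₀).continuousLinearMapAt ℝ x v =
      ((tangentTriv m x₀) (⟨x, v⟩ : TangentBundle (𝓡 m) M)).2 := by
  rw [Trivialization.continuousLinearMapAt_apply, Trivialization.coe_linearMapAt_of_mem _ hx]

theorem tangentTriv_symmL_injective {x₀ x : M} (hx : x ∈ (tangentTriv m x₀).baseSet) :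
    Function.Injective ((tangentTriv m x₀).symmL ℝ x) :=
  Function.LeftInverse.injective ((tangentTriv m x₀).continuousLinearMapAt_symmL (R := ℝ) hx)

theorem continuousOn_mk_tangentTriv_symmL {X : Type*} [TopologicalSpace X] {x₀ : M} {U : Set X}
    {q : X → M} (hq : ContinuousOn q U) (hU : ∀ x ∈ U, q x ∈ (tangentTriv m x₀).baseSet)
    {c : X → EuclideanSpace ℝ (Fin m)} (hc : ContinuousOn c U) :
    ContinuousOn (fun x => (⟨q x, (tangentTriv m x₀).symmL ℝ (q x) (c x)⟩ : TangentBundle (𝓡 m) M))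
      U := by
  have h : ContinuousOn (fun x => (tangentTriv m x₀).toOpenPartialHomeomorph.symm (q x, c x)) U := by
    refine (tangentTriv m x₀).toOpenPartialHomeomorph.continuousOn_symm.comp (hq.prodMk hc) ?_
    intro x hx
    exact (tangentTriv m x₀).mem_target.2 (hU x hx)
  exact h.congr fun x hx => mk_tangentTriv_symmL (hU x hx) (c x)

variable (m b) in
/-- The derivative of `h` read in the trivializations of the tangent bundles at `x₀`, `h x₀`. -/
def derivCoord (h : M → B) (x₀ x : M) : EuclideanSpace ℝ (Fin m) →L[ℝ] EuclideanSpace ℝ (Fin b) :=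
  ((tangentTriv b (h x₀)).continuousLinearMapAt ℝ (h x)).comp
    ((mfderiv (𝓡 m) (𝓡 b) h x).comp ((tangentTriv m x₀).symmL ℝ x))

theorem continuousOn_derivCoord {h : M → B} (hh : ContMDiff (𝓡 m) (𝓡 b) 1 h) (x₀ : M) :
    ContinuousOn (derivCoord m b h x₀)
      ((tangentTriv m x₀).baseSet ∩ h ⁻¹' (tangentTriv b (h x₀)).baseSet) := by
  rw [continuousOn_clm_apply]
  intro a
  have h1 : ContinuousOn (fun x => (⟨x, (tangentTriv m x₀).symmL ℝ x a⟩ : TangentBundle (𝓡 m) M))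
      ((tangentTriv m x₀).baseSet ∩ h ⁻¹' (tangentTriv b (h x₀)).baseSet) :=
    continuousOn_mk_tangentTriv_symmL continuousOn_id (fun x hx => hx.1) continuousOn_const
  have h2 := (hh.continuous_tangentMap le_rfl).comp_continuousOn h1
  have h3 : ContinuousOn (fun x => (tangentTriv b (h x₀) (tangentMap (𝓡 m) (𝓡 b) h
      ⟨x, (tangentTriv m x₀).symmL ℝ x a⟩)).2)
      ((tangentTriv m x₀).baseSet ∩ h ⁻¹' (tangentTriv b (h x₀)).baseSet) := by
    refine continuous_snd.comp_continuousOn ((tangentTriv b (h x₀)).continuousOn.comp h2 ?_)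
    intro x hx
    exact (tangentTriv b (h x₀)).mem_source.2 hx.2
  exact h3.congr fun x hx => continuousLinearMapAt_tangentTriv (m := b) hx.2 _

theorem isOpen_derivCoord_domain {h : M → B} (hh : Continuous h) (x₀ : M) :
    IsOpen ((tangentTriv m x₀).baseSet ∩ h ⁻¹' (tangentTriv b (h x₀)).baseSet) :=
  (tangentTriv m x₀).open_baseSet.inter ((tangentTriv b (h x₀)).open_baseSet.preimage hh)

theorem mem_derivCoord_domain (h : M → B) (x₀ : M) :
    x₀ ∈ (tangentTriv m x₀).baseSet ∩ h ⁻¹' (tangentTriv b (h x₀)).baseSet :=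
  ⟨mem_tangentTriv_baseSet (m := m) _, mem_tangentTriv_baseSet (m := b) _⟩

theorem derivCoord_surjective {h : M → B} {x₀ x : M}
    (hx : x ∈ (tangentTriv m x₀).baseSet ∩ h ⁻¹' (tangentTriv b (h x₀)).baseSet)
    (hs : Function.Surjective (mfderiv (𝓡 m) (𝓡 b) h x)) :
    Function.Surjective (derivCoord m b h x₀ x) := by
  intro a
  obtain ⟨w, hw⟩ := hs ((tangentTriv b (h x₀)).symmL ℝ (h x) a)
  refine ⟨(tangentTriv m x₀).continuousLinearMapAt ℝ x w, ?_⟩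
  have h1 := (tangentTriv m x₀).symmL_continuousLinearMapAt (R := ℝ) hx.1 w
  have h2 := (tangentTriv b (h x₀)).continuousLinearMapAt_symmL (R := ℝ) hx.2 a
  simp only [derivCoord, ContinuousLinearMap.comp_apply]
  erw [h1, hw, h2]

theorem mfderiv_symmL {h : M → B} {x₀ x : M}
    (hx : x ∈ (tangentTriv m x₀).baseSet ∩ h ⁻¹' (tangentTriv b (h x₀)).baseSet)
    (a : EuclideanSpace ℝ (Fin m)) :
    mfderiv (𝓡 m) (𝓡 b) h x ((tangentTriv m x₀).symmL ℝ x a) =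
      (tangentTriv b (h x₀)).symmL ℝ (h x) (derivCoord m b h x₀ x a) :=
  ((tangentTriv b (h x₀)).symmL_continuousLinearMapAt (R := ℝ) hx.2 _).symm

end Coordinates
end

/-! ### Submersions and smooth fiber bundles -/

noncomputable section
open Filter Set

section Submersion

variable {m b : ℕ}
  {M : Type*} [TopologicalSpace M] [ChartedSpace (EuclideanSpace ℝ (Fin m)) M]
  {B : Type*} [TopologicalSpace B] [ChartedSpace (EuclideanSpace ℝ (Fin b)) B]

instance (x : M) : FiniteDimensional ℝ (TangentSpace (𝓡 m) x) :=
  inferInstanceAs (FiniteDimensional ℝ (EuclideanSpace ℝ (Fin m)))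

theorem finrank_tangentSpace (x : M) : Module.finrank ℝ (TangentSpace (𝓡 m) x) = m :=
  finrank_euclideanSpace_fin (𝕜 := ℝ) (n := m)

variable [IsManifold (𝓡 m) ∞ M] [IsManifold (𝓡 b) ∞ B]

/-- A submersion of a compact manifold has right inverses of uniformly bounded norm. -/
theorem exists_bounded_lift [CompactSpace M] {π : M → B} (hπ : ContMDiff (𝓡 m) (𝓡 b) 1 π)
    (hs : ∀ p, Function.Surjective (mfderiv (𝓡 m) (𝓡 b) π p))
    (gM : SmoothMetric m M) (gB : SmoothMetric b B) :
    ∃ C : ℝ, 0 ≤ C ∧ ∀ p (v : TangentSpace (𝓡 b) (π p)), ∃ w : TangentSpace (𝓡 m) p,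
      mfderiv (𝓡 m) (𝓡 b) π p w = v ∧ gM.length p w ≤ C * gB.length (π p) v := by
  have hloc : ∀ p₀ : M, ∃ C : ℝ, 0 ≤ C ∧ ∀ᶠ p in 𝓝 p₀, ∀ v : TangentSpace (𝓡 b) (π p),
      ∃ w : TangentSpace (𝓡 m) p,
      mfderiv (𝓡 m) (𝓡 b) π p w = v ∧ gM.length p w ≤ C * gB.length (π p) v := by
    intro p₀
    obtain ⟨V, R, hV, hp₀, hVU, hR, hAR, -⟩ := exists_continuousOn_rightInverse
      (isOpen_derivCoord_domain hπ.continuous p₀) (continuousOn_derivCoord hπ p₀)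
      (mem_derivCoord_domain π p₀) (derivCoord_surjective (mem_derivCoord_domain π p₀) (hs p₀))
    obtain ⟨C₁, hC₁, h1⟩ := gM.exists_length_symmL_le p₀
    obtain ⟨C₂, hC₂, h2⟩ := gB.exists_norm_trivializationAt_le (π p₀)
    -- The local constant is the product of a bound for the right inverse in coordinates and the two
    -- constants comparing coordinates with lengths.
    have h3 : ∀ᶠ p in 𝓝 p₀, ‖R p‖ < ‖R p₀‖ + 1 :=
      ((hR.continuousAt (hV.mem_nhds hp₀)).norm).eventually_lt continuousAt_const (by simp)
    refine ⟨C₁ * ((‖R p₀‖ + 1) * C₂), by positivity, ?_⟩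
    filter_upwards [h1, hπ.continuous.continuousAt.eventually h2, h3, hV.mem_nhds hp₀]
      with p h1 h2 h3 hp v
    refine ⟨(tangentTriv m p₀).symmL ℝ p
      (R p ((tangentTriv b (π p₀)).continuousLinearMapAt ℝ (π p) v)), ?_, ?_⟩
    · rw [mfderiv_symmL (hVU hp), hAR p hp]
      exact (tangentTriv b (π p₀)).symmL_continuousLinearMapAt (R := ℝ) (hVU hp).2 v
    · refine (h1 _).trans ?_
      rw [mul_assoc]
      refine mul_le_mul_of_nonneg_left ?_ hC₁.le
      refine ((R p).le_opNorm _).trans ?_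
      rw [mul_assoc]
      exact mul_le_mul h3.le (h2 v) (norm_nonneg _) (by positivity)
  choose C hC hloc using hloc
  obtain ⟨t, ht⟩ := isCompact_univ.elim_nhds_subcover
    (fun p₀ : M => {p | ∀ v : TangentSpace (𝓡 b) (π p), ∃ w : TangentSpace (𝓡 m) p,
      mfderiv (𝓡 m) (𝓡 b) π p w = v ∧ gM.length p w ≤ C p₀ * gB.length (π p) v})
    (fun p₀ _ => hloc p₀)
  refine ⟨∑ p ∈ t, C p, Finset.sum_nonneg fun p _ => hC p, fun p v => ?_⟩
  obtain ⟨p₀, hp₀, hp⟩ := mem_iUnion₂.1 (ht.2 (mem_univ p))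
  obtain ⟨w, hw, hle⟩ := hp v
  refine ⟨w, hw, hle.trans (mul_le_mul_of_nonneg_right ?_ (gB.length_nonneg _ _))⟩
  exact Finset.single_le_sum (f := C) (fun p _ => hC p) hp₀

/-- The kernels of the derivatives of a submersion form a continuous subbundle. -/
theorem isContinuousSubbundle_verticalField {π : M → B} (hπ : ContMDiff (𝓡 m) (𝓡 b) 1 π)
    (hs : ∀ p, Function.Surjective (mfderiv (𝓡 m) (𝓡 b) π p)) :
    IsContinuousSubbundle (verticalField (m := m) (b := b) π) := by
  intro p₀
  obtain ⟨V, R, hV, hp₀, hVU, hR, hAR, hRange⟩ := exists_continuousOn_rightInverse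
    (isOpen_derivCoord_domain hπ.continuous p₀) (continuousOn_derivCoord hπ p₀)
    (mem_derivCoord_domain π p₀) (derivCoord_surjective (mem_derivCoord_domain π p₀) (hs p₀))
  set A := derivCoord m b π p₀ with hA_def
  have hA : ContinuousOn A V := (continuousOn_derivCoord hπ p₀).mono hVU
  let K := LinearMap.ker (A p₀).toLinearMap
  let k := Module.finBasis ℝ K
  -- `id - R p ∘ A p` projects onto `ker (A p)`. Applied to a fixed basis of `ker (A p₀)` it gives
  -- the frame.
  let c : M → EuclideanSpace ℝ (Fin m) → EuclideanSpace ℝ (Fin m) := fun p a => a - R p (A p a)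
  have hker : ∀ p, Function.Surjective (mfderiv (𝓡 m) (𝓡 b) π p) →
      Module.finrank ℝ (verticalField (m := m) (b := b) π p) + b = m := by
    intro p hp
    have h := LinearMap.finrank_range_add_finrank_ker (mfderiv (𝓡 m) (𝓡 b) π p).toLinearMap
    rw [LinearMap.range_eq_top.2 hp, finrank_top, finrank_tangentSpace, finrank_tangentSpace] at h
    exact (add_comm _ _).trans h
  have hK : Module.finrank ℝ K + b = m := by
    have h := LinearMap.finrank_range_add_finrank_ker (A p₀).toLinearMap
    rw [LinearMap.range_eq_top.2 (derivCoord_surjective (mem_derivCoord_domain π p₀) (hs p₀)),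
      finrank_top, finrank_euclideanSpace_fin, finrank_euclideanSpace_fin] at h
    exact (add_comm _ _).trans h
  refine ⟨Module.finrank ℝ K, V, fun i p => (tangentTriv m p₀).symmL ℝ p (c p (k i)), hV, hp₀,
    fun i => ?_, fun p hp => ?_⟩
  · refine continuousOn_mk_tangentTriv_symmL continuousOn_id (fun p hp => (hVU hp).1) ?_
    exact continuousOn_const.sub (hR.clm_apply (hA.clm_apply continuousOn_const))
  have hLI : LinearIndependent ℝ fun i => (tangentTriv m p₀).symmL ℝ p (c p (k i)) := by
    let φ : K →ₗ[ℝ] EuclideanSpace ℝ (Fin m) :=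
      (LinearMap.id - ((R p).comp (A p)).toLinearMap).comp K.subtype
    -- A vector of `ker (A p₀)` killed by the projection at `p` lies in the range of `R p`, hence in
    -- that of `R p₀`, where `A p₀` is injective.
    have hφ : LinearMap.ker φ = ⊥ := by
      rw [LinearMap.ker_eq_bot']
      rintro ⟨a, ha⟩ h
      have h1 : a = R p (A p a) := sub_eq_zero.1 h
      obtain ⟨y, hy⟩ := hRange p hp (A p a)
      have h2 : R p₀ y = a := hy.trans h1.symm
      have h3 : A p₀ (R p₀ y) = y := hAR p₀ hp₀ y
      have h4 : A p₀ a = 0 := ha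
      rw [h2, h4] at h3
      rw [← h3, map_zero] at h2
      exact Subtype.ext h2.symm
    have h1 := (k.linearIndependent.map' φ hφ).map' ((tangentTriv m p₀).symmL ℝ p).toLinearMap
      (LinearMap.ker_eq_bot.2 (tangentTriv_symmL_injective (hVU hp).1))
    exact h1
  refine ⟨hLI, Submodule.eq_of_le_of_finrank_eq ?_ ?_⟩
  · rw [Submodule.span_le]
    rintro _ ⟨i, rfl⟩
    change mfderiv (𝓡 m) (𝓡 b) π p _ = 0
    rw [mfderiv_symmL (hVU hp)]
    simp only [c, map_sub]
    rw [← hA_def, hAR p hp, sub_self]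
  · rw [finrank_span_eq_card hLI, Fintype.card_fin]
    have := hker p (hs p)
    omega

end Submersion

section FiberBundle

variable {m b d : ℕ}
  {M : Type*} [TopologicalSpace M] [ChartedSpace (EuclideanSpace ℝ (Fin m)) M]
  {B : Type*} [TopologicalSpace B] [ChartedSpace (EuclideanSpace ℝ (Fin b)) B]
  {F : Type*} [TopologicalSpace F] [ChartedSpace (EuclideanSpace ℝ (Fin d)) F] {π : M → B}

namespace IsSmoothFiberBundle

theorem contMDiff (hπ : IsSmoothFiberBundle (m := m) (b := b) d F π) :
    ContMDiff (𝓡 m) (𝓡 b) ∞ π := by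
  intro p
  obtain ⟨e, he, h1, -⟩ := hπ (π p)
  have hp : e.source ∈ 𝓝 p := e.open_source.mem_nhds (e.mem_source.2 he)
  have h2 : ContMDiffAt (𝓡 m) (𝓡 b) ∞ (fun q => (e q).1) p :=
    contMDiffAt_fst.comp p (h1.contMDiffAt hp)
  refine h2.congr_of_eventuallyEq ?_
  filter_upwards [hp] with q hq
  exact (e.coe_fst hq).symm

/-- One point of `M` yields a point of `F`, and a trivialization over `x` turns it into a point over
`x`. -/
theorem surjective [Nonempty M] (hπ : IsSmoothFiberBundle (m := m) (b := b) d F π) :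
    Function.Surjective π := by
  intro x
  obtain ⟨p⟩ := ‹Nonempty M›
  obtain ⟨e', he', -⟩ := hπ (π p)
  obtain ⟨e, he, -⟩ := hπ x
  exact ⟨e.toOpenPartialHomeomorph.symm (x, (e' p).2), e.proj_symm_apply (e.mem_target.2 he)⟩

theorem surjective_mfderiv (hπ : IsSmoothFiberBundle (m := m) (b := b) d F π) (p : M) :
    Function.Surjective (mfderiv (𝓡 m) (𝓡 b) π p) := by
  obtain ⟨e, he, -, h2⟩ := hπ (π p)
  -- Working at `e.symm q` with `q` free avoids transporting tangent vectors along `e.symm (e p) =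
  -- p`. There `π ∘ e.symm` is the first projection.
  have key : ∀ q ∈ e.target, Function.Surjective
      (mfderiv (𝓡 m) (𝓡 b) π (e.toOpenPartialHomeomorph.symm q)) := by
    intro q hq v
    have hsymm : MDifferentiableAt ((𝓡 b).prod (𝓡 d)) (𝓡 m) e.toOpenPartialHomeomorph.symm q :=
      (h2.contMDiffAt (e.open_target.mem_nhds hq)).mdifferentiableAt (by simp)
    have hcomp := mfderiv_comp q ((hπ.contMDiff _).mdifferentiableAt (by simp)) hsymm
    have heq : π ∘ e.toOpenPartialHomeomorph.symm =ᶠ[𝓝 q] Prod.fst := by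
      filter_upwards [e.open_target.mem_nhds hq] with q' hq'
      exact e.proj_symm_apply hq'
    rw [heq.mfderiv_eq, mfderiv_fst] at hcomp
    refine ⟨mfderiv ((𝓡 b).prod (𝓡 d)) (𝓡 m) e.toOpenPartialHomeomorph.symm q (v, 0), ?_⟩
    exact (DFunLike.congr_fun hcomp (v, 0)).symm
  have hp : p ∈ e.source := e.mem_source.2 he
  have h := key (e p) (e.map_source hp)
  have hpp : e.toOpenPartialHomeomorph.symm (e p) = p := e.toOpenPartialHomeomorph.left_inv hp
  rwa [hpp] at h

/-- A nonzero vector tangent to the factor `F` is carried by the inverse trivialization to a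
vertical vector, which is nonzero because the derivative of `e` carries it back. -/
theorem verticalField_ne_bot (hd : 0 < d) (hπ : IsSmoothFiberBundle (m := m) (b := b) d F π)
    (p : M) : verticalField (m := m) (b := b) π p ≠ ⊥ := by
  obtain ⟨e, he, h1, h2⟩ := hπ (π p)
  have key : ∀ q ∈ e.target,
      verticalField (m := m) (b := b) π (e.toOpenPartialHomeomorph.symm q) ≠ ⊥ := by
    intro q hq
    have hsymm : MDifferentiableAt ((𝓡 b).prod (𝓡 d)) (𝓡 m) e.toOpenPartialHomeomorph.symm q :=
      (h2.contMDiffAt (e.open_target.mem_nhds hq)).mdifferentiableAt (by simp)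
    have hcomp := mfderiv_comp q ((hπ.contMDiff _).mdifferentiableAt (by simp)) hsymm
    have heq : π ∘ e.toOpenPartialHomeomorph.symm =ᶠ[𝓝 q] Prod.fst := by
      filter_upwards [e.open_target.mem_nhds hq] with q' hq'
      exact e.proj_symm_apply hq'
    rw [heq.mfderiv_eq, mfderiv_fst] at hcomp
    have hsrc : e.toOpenPartialHomeomorph.symm q ∈ e.source := e.map_target hq
    have hcomp' := mfderiv_comp q
      ((h1.contMDiffAt (e.open_source.mem_nhds hsrc)).mdifferentiableAt (by simp)) hsymm
    have heq' : e ∘ e.toOpenPartialHomeomorph.symm =ᶠ[𝓝 q] id := by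
      filter_upwards [e.open_target.mem_nhds hq] with q' hq'
      exact e.toOpenPartialHomeomorph.right_inv hq'
    rw [heq'.mfderiv_eq, mfderiv_id] at hcomp'
    let u : TangentSpace (𝓡 d) q.2 := EuclideanSpace.single (⟨0, hd⟩ : Fin d) (1 : ℝ)
    have hu : u ≠ 0 := by
      intro h
      have := congrArg (fun z : EuclideanSpace ℝ (Fin d) => z ⟨0, hd⟩) h
      simp only [u, PiLp.single_apply, if_true] at this
      exact one_ne_zero this
    let w := mfderiv ((𝓡 b).prod (𝓡 d)) (𝓡 m) e.toOpenPartialHomeomorph.symm q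
      ((0 : TangentSpace (𝓡 b) q.1), u)
    refine (Submodule.ne_bot_iff _).2 ⟨w, ?_, fun hw => hu ?_⟩
    · exact (DFunLike.congr_fun hcomp ((0 : TangentSpace (𝓡 b) q.1), u)).symm
    · have h := DFunLike.congr_fun hcomp' ((0 : TangentSpace (𝓡 b) q.1), u)
      have h' : ((0 : TangentSpace (𝓡 b) q.1), u) = mfderiv (𝓡 m) ((𝓡 b).prod (𝓡 d)) e
        (e.toOpenPartialHomeomorph.symm q) w := h
      rw [hw, map_zero] at h'
      exact (Prod.ext_iff.1 h').2
  have hp : p ∈ e.source := e.mem_source.2 he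
  have h := key (e p) (e.map_source hp)
  have hpp : e.toOpenPartialHomeomorph.symm (e p) = p := e.toOpenPartialHomeomorph.left_inv hp
  rwa [hpp] at h

end IsSmoothFiberBundle

end FiberBundle
end

/-! ### From pointwise to uniform contraction -/

noncomputable section
open Filter Set

theorem IsCompact.exists_lt_forall_le {X : Type*} [TopologicalSpace X] {s : Set X}
    (hs : IsCompact s) {f : X → ℝ} (hf : ContinuousOn f s) {a : ℝ} (hfa : ∀ x ∈ s, f x < a) :
    ∃ c < a, ∀ x ∈ s, f x ≤ c :=
  IsCompact.exists_forall_le' (α := ℝᵒᵈ) hs hf hfa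

section Uniform

variable {n : ℕ} {M : Type*} [TopologicalSpace M] [ChartedSpace (EuclideanSpace ℝ (Fin n)) M]
  [IsManifold (𝓡 n) ∞ M]

/-- Parametrizes a subbundle by base point and frame coefficients, so that compactness of the
coefficient sphere can be used. Sums make sense only inside fibers, so continuity is checked in a
trivialization. -/
theorem continuousOn_mk_sum_smul {r : ℕ} {U : Set M}
    {s : Fin r → ∀ x : M, TangentSpace (𝓡 n) x}
    (hs : ∀ i, ContinuousOn (fun x => (⟨x, s i x⟩ : TangentBundle (𝓡 n) M)) U) :
    ContinuousOn (fun q : M × (Fin r → ℝ) =>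
      (⟨q.1, ∑ i, q.2 i • s i q.1⟩ : TangentBundle (𝓡 n) M)) (U ×ˢ univ) := by
  rintro ⟨x, a⟩ ⟨hx, -⟩
  rw [FiberBundle.continuousWithinAt_totalSpace]
  refine ⟨continuous_fst.continuousWithinAt, ?_⟩
  have hfst : ContinuousWithinAt (Prod.fst : M × (Fin r → ℝ) → M) (U ×ˢ univ) (x, a) :=
    continuous_fst.continuousWithinAt
  have hmaps : MapsTo (Prod.fst : M × (Fin r → ℝ) → M) (U ×ˢ univ) U := fun q hq => hq.1
  have h1 : ContinuousWithinAt (fun q : M × (Fin r → ℝ) =>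
      ∑ i, q.2 i • ((tangentTriv n x) (⟨q.1, s i q.1⟩ : TangentBundle (𝓡 n) M)).2)
      (U ×ˢ univ) (x, a) := by
    refine tendsto_finsetSum _ fun i _ => ?_
    have h2 : ContinuousWithinAt (fun y : M =>
        ((tangentTriv n x) (⟨y, s i y⟩ : TangentBundle (𝓡 n) M)).2) U x := ((FiberBundle.continuousWithinAt_totalSpace _ _).1 (hs i x hx)).2
    have h3 : ContinuousWithinAt (fun q : M × (Fin r → ℝ) =>
        ((tangentTriv n x) (⟨q.1, s i q.1⟩ : TangentBundle (𝓡 n) M)).2)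
        (U ×ˢ univ) (x, a) :=
      ContinuousWithinAt.comp (g := fun y : M =>
        ((tangentTriv n x) (⟨y, s i y⟩ : TangentBundle (𝓡 n) M)).2) (x := (x, a)) h2 hfst hmaps
    have h4 : ContinuousWithinAt (fun q : M × (Fin r → ℝ) => q.2 i) (U ×ˢ univ) (x, a) :=
      ((continuous_apply i).comp continuous_snd).continuousWithinAt
    exact h4.smul h3
  have hev : ∀ᶠ q : M × (Fin r → ℝ) in 𝓝[U ×ˢ univ] (x, a), q.1 ∈ (tangentTriv n x).baseSet :=
    hfst.eventually (tangentTriv_baseSet_mem_nhds x)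
  have heq : ∀ q : M × (Fin r → ℝ), q.1 ∈ (tangentTriv n x).baseSet →
      ((tangentTriv n x) (⟨q.1, ∑ i, q.2 i • s i q.1⟩ : TangentBundle (𝓡 n) M)).2 =
      ∑ i, q.2 i • ((tangentTriv n x) (⟨q.1, s i q.1⟩ : TangentBundle (𝓡 n) M)).2 := by
    intro q hq
    simp only [← continuousLinearMapAt_tangentTriv hq, map_sum, map_smul]
  exact h1.congr_of_eventuallyEq (hev.mono heq) (heq (x, a) (mem_tangentTriv_baseSet x))

/-- A continuous bundle map that strictly decreases length on a continuous subbundle over a compact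
manifold does so uniformly. -/
theorem exists_uniform_contraction [CompactSpace M] [T2Space M] (g : SmoothMetric n M)
    {E : PlaneField n M} (hE : IsContinuousSubbundle E) {h : M → M}
    (hh : ContMDiff (𝓡 n) (𝓡 n) 1 h) {a : ℝ} (ha : 0 < a)
    (hlt : ∀ x, ∀ v ∈ E x, v ≠ 0 →
      g.length (h x) (mfderiv (𝓡 n) (𝓡 n) h x v) < a * g.length x v) :
    ∃ c, 0 < c ∧ c < a ∧ ∀ x, ∀ v ∈ E x,
      g.length (h x) (mfderiv (𝓡 n) (𝓡 n) h x v) ≤ c * g.length x v := by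
  have hloc : ∀ x₀ : M, ∃ c, 0 < c ∧ c < a ∧ ∀ᶠ x in 𝓝 x₀, ∀ v ∈ E x,
      g.length (h x) (mfderiv (𝓡 n) (𝓡 n) h x v) ≤ c * g.length x v := by
    intro x₀
    obtain ⟨r, U, s, hU, hx₀, hs, hspan⟩ := hE x₀
    obtain ⟨K, hK, hKU, hKc⟩ := local_compact_nhds (hU.mem_nhds hx₀)
    let Φ : M × (Fin r → ℝ) → TangentBundle (𝓡 n) M := fun q => ⟨q.1, ∑ i, q.2 i • s i q.1⟩
    have hΦ : ContinuousOn Φ (K ×ˢ Metric.sphere 0 1) :=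
      (continuousOn_mk_sum_smul hs).mono (prod_mono hKU (subset_univ _))
    have hmem : ∀ x ∈ U, ∀ α : Fin r → ℝ, ∑ i, α i • s i x ∈ E x := by
      intro x hx α
      rw [← (hspan x hx).2]
      exact Submodule.sum_mem _ fun i _ =>
        Submodule.smul_mem _ _ (Submodule.subset_span (mem_range_self i))
    have hne : ∀ q ∈ K ×ˢ Metric.sphere (0 : Fin r → ℝ) 1, (Φ q).2 ≠ 0 := by
      rintro ⟨x, α⟩ ⟨hx, hα⟩ h0
      have h1 : α = 0 := funext
        (Fintype.linearIndependent_iff.1 (hspan x (hKU hx)).1 α h0)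
      rw [mem_sphere_zero_iff_norm, h1, norm_zero] at hα
      exact zero_ne_one hα
    -- The stretching ratio is continuous on a compact set of nonzero vectors. It is invariant under
    -- scaling, so unit coefficient vectors suffice.
    obtain ⟨c, hca, hc⟩ := (hKc.prod (isCompact_sphere (0 : Fin r → ℝ) 1)).exists_lt_forall_le
      (f := fun q => g.length (h (Φ q).1) (mfderiv (𝓡 n) (𝓡 n) h (Φ q).1 (Φ q).2) /
        g.length (Φ q).1 (Φ q).2) (a := a)
      ((g.continuous_length.comp_continuousOn
        ((hh.continuous_tangentMap le_rfl).comp_continuousOn hΦ)).div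
        (g.continuous_length.comp_continuousOn hΦ)
        fun q hq => (g.length_pos (hne q hq)).ne')
      (fun q hq => (div_lt_iff₀ (g.length_pos (hne q hq))).2
        (hlt _ _ (hmem _ (hKU hq.1) _) (hne q hq)))
    -- The maximum with `a / 2` makes the constant positive, also when the subbundle is zero and `c`
    -- carries no information.
    refine ⟨max c (a / 2), lt_max_of_lt_right (half_pos ha), max_lt hca (half_lt_self ha), ?_⟩
    filter_upwards [hK] with x hx v hv
    rcases eq_or_ne v 0 with rfl | hv0
    · simp
    rw [← (hspan x (hKU hx)).2] at hv
    obtain ⟨α, rfl⟩ := (Submodule.mem_span_range_iff_exists_fun ℝ).1 hv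
    have hα : α ≠ 0 := by rintro rfl; simp at hv0
    have hα' : 0 < ‖α‖ := norm_pos_iff.2 hα
    have hβ : ‖α‖⁻¹ • α ∈ Metric.sphere (0 : Fin r → ℝ) 1 := by
      rw [mem_sphere_zero_iff_norm, norm_smul, norm_inv, norm_norm, inv_mul_cancel₀ hα'.ne']
    have h1 := hc (x, ‖α‖⁻¹ • α) ⟨hx, hβ⟩
    rw [div_le_iff₀ (g.length_pos (hne (x, ‖α‖⁻¹ • α) ⟨hx, hβ⟩))] at h1
    have h2 : (Φ (x, ‖α‖⁻¹ • α)).2 = ‖α‖⁻¹ • ∑ i, α i • s i x := by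
      simp only [Φ, Finset.smul_sum, Pi.smul_apply, smul_eq_mul, mul_smul]
    rw [h2, map_smul] at h1
    change g.length (h x) _ ≤ c * g.length x _ at h1
    rw [g.length_smul, g.length_smul, mul_left_comm, mul_le_mul_iff_right₀ (by positivity)] at h1
    exact h1.trans (mul_le_mul_of_nonneg_right (le_max_left _ _) (g.length_nonneg _ _))
  choose c hc hca hloc using hloc
  obtain ⟨t, -, ht⟩ := isCompact_univ.elim_nhds_subcover
    (fun x₀ : M => {x | ∀ v ∈ E x,
      g.length (h x) (mfderiv (𝓡 n) (𝓡 n) h x v) ≤ c x₀ * g.length x v})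
    (fun x₀ _ => hloc x₀)
  obtain ⟨C, hCa, hC⟩ := t.finite_toSet.isCompact.exists_lt_forall_le (f := c)
    (Set.Finite.continuousOn t.finite_toSet c) (a := a) (fun x _ => hca x)
  refine ⟨max C (a / 2), lt_max_of_lt_right (half_pos ha), max_lt hCa (half_lt_self ha),
    fun x v hv => ?_⟩
  obtain ⟨x₀, hx₀, hx⟩ := mem_iUnion₂.1 (ht (mem_univ x))
  exact (hx v hv).trans (mul_le_mul_of_nonneg_right ((hC x₀ hx₀).trans (le_max_left _ _))
    (g.length_nonneg _ _))

end Uniform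
end

/-! ### Tangent maps of diffeomorphisms and invariant fields -/

noncomputable section
open Filter Set

section TotalSpace

variable {n b : ℕ} {M : Type*} [TopologicalSpace M] [ChartedSpace (EuclideanSpace ℝ (Fin n)) M]
  {B : Type*} [TopologicalSpace B] [ChartedSpace (EuclideanSpace ℝ (Fin b)) B]

/-- Orbits of vectors are iterated in the total space, which avoids casts between fibers. This
recovers fiberwise linearity when it is needed. -/
theorem exists_linear_tangentMap_iterate (f : M → M) (k : ℕ) (p : M) :
    ∃ A : TangentSpace (𝓡 n) p →L[ℝ] TangentSpace (𝓡 n) (f^[k] p),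
      ∀ w, (tangentMap (𝓡 n) (𝓡 n) f)^[k] ⟨p, w⟩ = ⟨f^[k] p, A w⟩ := by
  induction k generalizing p with
  | zero => exact ⟨ContinuousLinearMap.id ℝ _, fun w => rfl⟩
  | succ k ih =>
    obtain ⟨A, hA⟩ := ih (f p)
    exact ⟨A.comp (mfderiv (𝓡 n) (𝓡 n) f p), fun w => hA _⟩

theorem tangentMap_iterate_fst (f : M → M) (k : ℕ) (w : TangentBundle (𝓡 n) M) :
    ((tangentMap (𝓡 n) (𝓡 n) f)^[k] w).1 = f^[k] w.1 := by
  obtain ⟨A, hA⟩ := exists_linear_tangentMap_iterate (n := n) f k w.1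
  rw [show w = ⟨w.1, w.2⟩ from rfl, hA]

theorem diffeomorph_tangentMap_symm_apply {k : ℕ∞ω} (hk : 1 ≤ k) (f : M ≃ₘ^k⟮𝓡 n, 𝓡 n⟯ M)
    (w : TangentBundle (𝓡 n) M) :
    tangentMap (𝓡 n) (𝓡 n) f.symm (tangentMap (𝓡 n) (𝓡 n) f w) = w := by
  have hk0 : k ≠ 0 := (zero_lt_one.trans_le hk).ne'
  have h := tangentMap_comp (I := 𝓡 n) (I' := 𝓡 n) (I'' := 𝓡 n) (f := f) (g := f.symm)
    (f.symm.contMDiff.mdifferentiable hk0) (f.contMDiff.mdifferentiable hk0)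
  have h' : f.symm ∘ f = id := funext f.symm_apply_apply
  rw [h', tangentMap_id] at h
  exact (congrFun h w).symm

theorem diffeomorph_tangentMap_apply_symm {k : ℕ∞ω} (hk : 1 ≤ k) (f : M ≃ₘ^k⟮𝓡 n, 𝓡 n⟯ M)
    (w : TangentBundle (𝓡 n) M) :
    tangentMap (𝓡 n) (𝓡 n) f (tangentMap (𝓡 n) (𝓡 n) f.symm w) = w :=
  diffeomorph_tangentMap_symm_apply hk f.symm w

theorem diffeomorph_mfderiv_injective {k : ℕ∞ω} (hk : 1 ≤ k) (f : M ≃ₘ^k⟮𝓡 n, 𝓡 n⟯ M) (p : M) :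
    Function.Injective (mfderiv (𝓡 n) (𝓡 n) f p) := by
  intro v w hvw
  have h : tangentMap (𝓡 n) (𝓡 n) f ⟨p, v⟩ = tangentMap (𝓡 n) (𝓡 n) f ⟨p, w⟩ := by
    simp only [tangentMap, hvw]
  have h' := congrArg (tangentMap (𝓡 n) (𝓡 n) f.symm) h
  rw [diffeomorph_tangentMap_symm_apply hk, diffeomorph_tangentMap_symm_apply hk] at h'
  simpa using h'

theorem diffeomorph_mfderiv_surjective {k : ℕ∞ω} (hk : 1 ≤ k) (f : M ≃ₘ^k⟮𝓡 n, 𝓡 n⟯ M) (p : M) :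
    Function.Surjective (mfderiv (𝓡 n) (𝓡 n) f p) := by
  have h : Function.Injective (mfderiv (𝓡 n) (𝓡 n) f p).toLinearMap :=
    diffeomorph_mfderiv_injective hk f p
  exact (LinearMap.injective_iff_surjective_of_finrank_eq_finrank
    ((finrank_tangentSpace p).trans (finrank_tangentSpace (f p)).symm)).1 h

theorem tangentMap_semiconj {π : M → B} (hπ : ContMDiff (𝓡 n) (𝓡 b) 1 π)
    {f : M ≃ₘ^∞⟮𝓡 n, 𝓡 n⟯ M} {fbar : B ≃ₘ^1⟮𝓡 b, 𝓡 b⟯ B} (hcover : ∀ p, π (f p) = fbar (π p))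
    (w : TangentBundle (𝓡 n) M) :
    tangentMap (𝓡 n) (𝓡 b) π (tangentMap (𝓡 n) (𝓡 n) f w) =
      tangentMap (𝓡 b) (𝓡 b) fbar (tangentMap (𝓡 n) (𝓡 b) π w) := by
  have h1 := tangentMap_comp (I := 𝓡 n) (I' := 𝓡 n) (I'' := 𝓡 b) (f := f) (g := π)
    (hπ.mdifferentiable one_ne_zero) (f.contMDiff.mdifferentiable (by simp))
  have h2 := tangentMap_comp (I := 𝓡 n) (I' := 𝓡 b) (I'' := 𝓡 b) (f := π) (g := fbar)
    (fbar.contMDiff.mdifferentiable one_ne_zero) (hπ.mdifferentiable one_ne_zero)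
  have h3 : π ∘ f = fbar ∘ π := funext hcover
  rw [h3, h2] at h1
  exact (congrFun h1 w).symm

variable [IsManifold (𝓡 n) ∞ M] [IsManifold (𝓡 b) ∞ B]

/-- Limits have equal base points, and then equal images in one trivialization. The continuity proof
for the lifted bundle needs unique limits in `TB`. -/
theorem tangentBundle_t2Space [T2Space M] : T2Space (TangentBundle (𝓡 n) M) := by
  rw [t2_iff_ultrafilter]
  intro v w u hv hw
  have hcont := FiberBundle.continuous_proj (EuclideanSpace ℝ (Fin n))
    (TangentSpace (𝓡 n) : M → Type)
  have h1 : v.1 = w.1 :=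
    tendsto_nhds_unique ((hcont.tendsto v).mono_left hv) ((hcont.tendsto w).mono_left hw)
  set e := tangentTriv n v.1
  have hvs : v ∈ e.source := e.mem_source.2 (mem_tangentTriv_baseSet v.1)
  have hws : w ∈ e.source := e.mem_source.2 (h1 ▸ mem_tangentTriv_baseSet v.1)
  have h2 : e v = e w := tendsto_nhds_unique ((e.continuousAt hvs).tendsto.mono_left hv)
    ((e.continuousAt hws).tendsto.mono_left hw)
  exact e.injOn hvs hws h2

open scoped Bundle in
theorem isCompact_setOf_length_le (g : SmoothMetric n M) (p : M) (R : ℝ) :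
    IsCompact {w : TangentSpace (𝓡 n) p | g.length p w ≤ R} := by
  let : Bundle.RiemannianBundle (fun x : M => TangentSpace (𝓡 n) x) := ⟨g.toRiemannianMetric⟩
  have : ProperSpace (TangentSpace (𝓡 n) p) := FiniteDimensional.proper ℝ _
  have h := isCompact_closedBall (0 : TangentSpace (𝓡 n) p) R
  have hset : {w : TangentSpace (𝓡 n) p | g.length p w ≤ R} = Metric.closedBall 0 R := by
    ext w
    rw [mem_closedBall_zero_iff, ← g.length_eq_norm]
    rfl
  rw [hset]
  exact h

/-- The length of the image is bounded on the compact unit disc bundle; homogeneity does the rest.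
-/
theorem exists_length_mfderiv_le [CompactSpace M] (gM : SmoothMetric n M) (gB : SmoothMetric b B)
    {h : M → B} (hh : ContMDiff (𝓡 n) (𝓡 b) 1 h) :
    ∃ L : ℝ, 0 ≤ L ∧ ∀ p (w : TangentSpace (𝓡 n) p),
      gB.length (h p) (mfderiv (𝓡 n) (𝓡 b) h p w) ≤ L * gM.length p w := by
  obtain ⟨L, hL⟩ := (gM.isCompact_length_le 1).exists_bound_of_continuousOn
    (gB.continuous_length.comp (hh.continuous_tangentMap le_rfl)).continuousOn
  refine ⟨max L 0, le_max_right _ _, fun p w => ?_⟩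
  rcases eq_or_ne w 0 with rfl | hw
  · simp
  have hw' := gM.length_pos hw
  have h1 : gM.length p ((gM.length p w)⁻¹ • w) = 1 := by
    rw [gM.length_smul, abs_of_pos (inv_pos.2 hw'), inv_mul_cancel₀ hw'.ne']
  have h2 := hL ⟨p, (gM.length p w)⁻¹ • w⟩ h1.le
  rw [Real.norm_eq_abs] at h2
  have h3 : gB.length (h p) (mfderiv (𝓡 n) (𝓡 b) h p ((gM.length p w)⁻¹ • w)) ≤ max L 0 :=
    ((le_abs_self _).trans h2).trans (le_max_left _ _)
  rwa [map_smul, gB.length_smul, abs_of_pos (inv_pos.2 hw'), inv_mul_le_iff₀ hw',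
    mul_comm] at h3

end TotalSpace

section Invariance

variable {n : ℕ} {M : Type*} [TopologicalSpace M] [ChartedSpace (EuclideanSpace ℝ (Fin n)) M]
  {k : ℕ∞ω} {f : M ≃ₘ^k⟮𝓡 n, 𝓡 n⟯ M} {E : PlaneField n M}

/-- The two-sided membership form passes at once to iterates and to the inverse. It rests on
bijectivity of the derivative. -/
theorem isDInvariant_iff (hk : 1 ≤ k) : IsDInvariant f E ↔ ∀ v : TangentBundle (𝓡 n) M,
    (tangentMap (𝓡 n) (𝓡 n) f v).2 ∈ E (tangentMap (𝓡 n) (𝓡 n) f v).1 ↔ v.2 ∈ E v.1 := by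
  constructor
  · intro h v
    change mfderiv (𝓡 n) (𝓡 n) f v.1 v.2 ∈ E (f v.1) ↔ _
    rw [← h v.1]
    constructor
    · rintro ⟨w, hw, hwv⟩
      rwa [← diffeomorph_mfderiv_injective hk f v.1 hwv]
    · exact fun hv => ⟨v.2, hv, rfl⟩
  · intro h x
    apply le_antisymm
    · rintro _ ⟨w, hw, rfl⟩
      exact (h ⟨x, w⟩).2 hw
    · intro w' hw'
      obtain ⟨w, rfl⟩ := diffeomorph_mfderiv_surjective hk f x w'
      exact ⟨w, (h ⟨x, w⟩).1 hw', rfl⟩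

theorem IsDInvariant.symm (hk : 1 ≤ k) (h : IsDInvariant f E) : IsDInvariant f.symm E := by
  rw [isDInvariant_iff hk] at h ⊢
  intro v
  rw [← h, diffeomorph_tangentMap_apply_symm hk]

end Invariance
end

/-! ### Dominated lifts: the contracting field and its uniqueness -/

noncomputable section
open Filter Set

section Dominated

variable {m b : ℕ}
  {M : Type*} [TopologicalSpace M] [ChartedSpace (EuclideanSpace ℝ (Fin m)) M]
  [IsManifold (𝓡 m) ∞ M]
  {B : Type*} [TopologicalSpace B] [ChartedSpace (EuclideanSpace ℝ (Fin b)) B]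
  [IsManifold (𝓡 b) ∞ B]

/-- The diffeomorphism `f` covers `fbar` under the submersion `π`, and `fbar` contracts the
invariant subbundle `E` at a rate `c` that is dominated by the rate `δ⁻¹` at which `f` can contract
the kernel of `Dπ`. -/
structure IsDominatedLift (gM : SmoothMetric m M) (gB : SmoothMetric b B) (π : M → B)
    (f : M ≃ₘ^∞⟮𝓡 m, 𝓡 m⟯ M) (fbar : B ≃ₘ^1⟮𝓡 b, 𝓡 b⟯ B) (E : PlaneField b B) (δ c : ℝ) :
    Prop where
  contMDiff : ContMDiff (𝓡 m) (𝓡 b) 1 π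
  surjective : ∀ p, Function.Surjective (mfderiv (𝓡 m) (𝓡 b) π p)
  cover : ∀ p, π (f p) = fbar (π p)
  subbundle : IsContinuousSubbundle E
  invariant : IsDInvariant fbar E
  δ_nonneg : 0 ≤ δ
  c_pos : 0 < c
  mul_lt_one : δ * c < 1
  vertical_le : ∀ p (w : TangentSpace (𝓡 m) p), mfderiv (𝓡 m) (𝓡 b) π p w = 0 →
    gM.length p w ≤ δ * gM.length (f p) (mfderiv (𝓡 m) (𝓡 m) f p w)
  contract : ∀ x, ∀ v ∈ E x,
    gB.length (fbar x) (mfderiv (𝓡 b) (𝓡 b) fbar x v) ≤ c * gB.length x v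

/-- The vectors over `E` whose iterates under `Df` decay at least at the rate `c`. -/
def contractingField (gM : SmoothMetric m M) (π : M → B) (f : M → M) (E : PlaneField b B) (c : ℝ) :
    PlaneField m M := fun p =>
  -- `C` may depend on `w`, which makes the set a subspace. A uniform constant is recovered in
  -- `exists_contractingField_bound`.
  { carrier := {w | mfderiv (𝓡 m) (𝓡 b) π p w ∈ E (π p) ∧ ∃ C : ℝ, ∀ k : ℕ,
      gM.length ((tangentMap (𝓡 m) (𝓡 m) f)^[k] ⟨p, w⟩).1
        ((tangentMap (𝓡 m) (𝓡 m) f)^[k] ⟨p, w⟩).2 ≤ C * c ^ k}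
    add_mem' := by
      rintro v w ⟨hv, C, hC⟩ ⟨hw, D, hD⟩
      refine ⟨by rw [map_add]; exact add_mem hv hw, C + D, fun k => ?_⟩
      obtain ⟨A, hA⟩ := exists_linear_tangentMap_iterate (n := m) f k p
      have h1 := hC k
      have h2 := hD k
      rw [hA] at h1 h2 ⊢
      rw [map_add, add_mul]
      exact (gM.length_add_le _ _ _).trans (add_le_add h1 h2)
    zero_mem' := by
      refine ⟨by rw [map_zero]; exact zero_mem _, 0, fun k => ?_⟩
      obtain ⟨A, hA⟩ := exists_linear_tangentMap_iterate (n := m) f k p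
      rw [hA, map_zero, gM.length_zero, zero_mul]
    smul_mem' := by
      rintro a w ⟨hw, C, hC⟩
      refine ⟨by rw [map_smul]; exact Submodule.smul_mem _ _ hw, |a| * C, fun k => ?_⟩
      obtain ⟨A, hA⟩ := exists_linear_tangentMap_iterate (n := m) f k p
      have h1 := hC k
      rw [hA] at h1 ⊢
      rw [map_smul, gM.length_smul, mul_assoc]
      exact mul_le_mul_of_nonneg_left h1 (abs_nonneg a) }

namespace IsDominatedLift

variable {gM : SmoothMetric m M} {gB : SmoothMetric b B} {π : M → B}
  {f : M ≃ₘ^∞⟮𝓡 m, 𝓡 m⟯ M} {fbar : B ≃ₘ^1⟮𝓡 b, 𝓡 b⟯ B} {E : PlaneField b B} {δ c : ℝ}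

theorem tangentMap_cover (h : IsDominatedLift gM gB π f fbar E δ c)
    (w : TangentBundle (𝓡 m) M) :
    tangentMap (𝓡 m) (𝓡 b) π (tangentMap (𝓡 m) (𝓡 m) f w) =
      tangentMap (𝓡 b) (𝓡 b) fbar (tangentMap (𝓡 m) (𝓡 b) π w) :=
  tangentMap_semiconj h.contMDiff h.cover w

theorem tangentMap_iterate_cover (h : IsDominatedLift gM gB π f fbar E δ c)
    (k : ℕ) (w : TangentBundle (𝓡 m) M) :
    tangentMap (𝓡 m) (𝓡 b) π ((tangentMap (𝓡 m) (𝓡 m) f)^[k] w) =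
      (tangentMap (𝓡 b) (𝓡 b) fbar)^[k] (tangentMap (𝓡 m) (𝓡 b) π w) :=
  Function.Semiconj.iterate_right (f := tangentMap (𝓡 m) (𝓡 b) π)
    (ga := tangentMap (𝓡 m) (𝓡 m) f) (gb := tangentMap (𝓡 b) (𝓡 b) fbar) h.tangentMap_cover k w

theorem mem_tangentMap_iff (h : IsDominatedLift gM gB π f fbar E δ c)
    (v : TangentBundle (𝓡 b) B) :
    (tangentMap (𝓡 b) (𝓡 b) fbar v).2 ∈ E (tangentMap (𝓡 b) (𝓡 b) fbar v).1 ↔ v.2 ∈ E v.1 :=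
  (isDInvariant_iff le_rfl).1 h.invariant v

theorem mem_iterate (h : IsDominatedLift gM gB π f fbar E δ c)
    {v : TangentBundle (𝓡 b) B} (hv : v.2 ∈ E v.1) (k : ℕ) :
    ((tangentMap (𝓡 b) (𝓡 b) fbar)^[k] v).2 ∈ E ((tangentMap (𝓡 b) (𝓡 b) fbar)^[k] v).1 := by
  induction k with
  | zero => exact hv
  | succ k ih => rw [Function.iterate_succ_apply']; exact (h.mem_tangentMap_iff _).2 ih

theorem length_iterate_le (h : IsDominatedLift gM gB π f fbar E δ c)
    {v : TangentBundle (𝓡 b) B} (hv : v.2 ∈ E v.1) (k : ℕ) :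
    gB.length ((tangentMap (𝓡 b) (𝓡 b) fbar)^[k] v).1 ((tangentMap (𝓡 b) (𝓡 b) fbar)^[k] v).2 ≤
      c ^ k * gB.length v.1 v.2 := by
  induction k with
  | zero => simp
  | succ k ih =>
    rw [Function.iterate_succ_apply', pow_succ', mul_assoc]
    exact (h.contract _ _ (h.mem_iterate hv k)).trans (mul_le_mul_of_nonneg_left ih h.c_pos.le)

theorem vertical_iterate (h : IsDominatedLift gM gB π f fbar E δ c)
    {w : TangentBundle (𝓡 m) M} (hw : mfderiv (𝓡 m) (𝓡 b) π w.1 w.2 = 0)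
    (k : ℕ) : mfderiv (𝓡 m) (𝓡 b) π ((tangentMap (𝓡 m) (𝓡 m) f)^[k] w).1
      ((tangentMap (𝓡 m) (𝓡 m) f)^[k] w).2 = 0 := by
  have h1 := h.tangentMap_iterate_cover k w
  have h2 : tangentMap (𝓡 m) (𝓡 b) π w = ⟨π w.1, 0⟩ := by simp only [tangentMap, hw]
  obtain ⟨A, hA⟩ := exists_linear_tangentMap_iterate (n := b) fbar k (π w.1)
  rw [h2, hA, map_zero] at h1
  have h3 : π ((tangentMap (𝓡 m) (𝓡 m) f)^[k] w).1 = fbar^[k] (π w.1) :=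
    congrArg Bundle.TotalSpace.proj h1
  -- The two base points in `h1` are not definitionally equal, so the equality is destructed with
  -- both of them free.
  have key : ∀ (y : B) (v : TangentSpace (𝓡 b) y) (y' : B),
      (⟨y, v⟩ : TangentBundle (𝓡 b) B) = ⟨y', 0⟩ → v = 0 := by
    rintro y v y' hv
    cases hv
    rfl
  exact key _ _ _ h1

theorem vertical_length_le (h : IsDominatedLift gM gB π f fbar E δ c)
    {w : TangentBundle (𝓡 m) M}
    (hw : mfderiv (𝓡 m) (𝓡 b) π w.1 w.2 = 0) (k : ℕ) :
    gM.length w.1 w.2 ≤ δ ^ k * gM.length ((tangentMap (𝓡 m) (𝓡 m) f)^[k] w).1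
      ((tangentMap (𝓡 m) (𝓡 m) f)^[k] w).2 := by
  induction k with
  | zero => simp
  | succ k ih =>
    refine ih.trans ?_
    rw [pow_succ, mul_assoc, Function.iterate_succ_apply']
    exact mul_le_mul_of_nonneg_left (h.vertical_le _ _ (h.vertical_iterate hw k))
      (pow_nonneg h.δ_nonneg k)

/-- Domination: vertical vectors satisfy `|w| ≤ δ ^ k |Df^k w|`, and membership bounds the right
side by `C (δ c) ^ k`. -/
theorem eq_zero_of_mem_contractingField (h : IsDominatedLift gM gB π f fbar E δ c)
    {p : M} {w : TangentSpace (𝓡 m) p}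
    (hw : w ∈ contractingField gM π f E c p) (hw0 : mfderiv (𝓡 m) (𝓡 b) π p w = 0) : w = 0 := by
  obtain ⟨-, C, hC⟩ := hw
  have h1 : ∀ k : ℕ, gM.length p w ≤ C * (δ * c) ^ k := by
    intro k
    refine (h.vertical_length_le (w := ⟨p, w⟩) hw0 k).trans ?_
    rw [mul_pow, mul_left_comm]
    exact mul_le_mul_of_nonneg_left (hC k) (pow_nonneg h.δ_nonneg k)
  have h2 : Tendsto (fun k : ℕ => C * (δ * c) ^ k) atTop (𝓝 (C * 0)) :=
    (tendsto_pow_atTop_nhds_zero_of_lt_one (mul_nonneg h.δ_nonneg h.c_pos.le)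
      h.mul_lt_one).const_mul C
  rw [mul_zero] at h2
  exact gM.length_eq_zero.1 (le_antisymm (ge_of_tendsto' h2 h1) (gM.length_nonneg p w))

/-- If `Dπ (Df w)` controls the length of `Df w`, then `Dπ w` controls the length of `w` with the
same constant. -/
theorem exists_length_le_of_tangentMap (h : IsDominatedLift gM gB π f fbar E δ c)
    [CompactSpace M] :
    ∃ K : ℝ, 0 ≤ K ∧
      (∀ p (v : TangentSpace (𝓡 b) (π p)), ∃ w : TangentSpace (𝓡 m) p,
        mfderiv (𝓡 m) (𝓡 b) π p w = v ∧ gM.length p w ≤ K * gB.length (π p) v) ∧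
      ∀ p (w : TangentSpace (𝓡 m) p), mfderiv (𝓡 m) (𝓡 b) π p w ∈ E (π p) →
        gM.length (f p) (mfderiv (𝓡 m) (𝓡 m) f p w) ≤
          K * gB.length (fbar (π p)) (mfderiv (𝓡 b) (𝓡 b) fbar (π p)
            (mfderiv (𝓡 m) (𝓡 b) π p w)) →
        gM.length p w ≤ K * gB.length (π p) (mfderiv (𝓡 m) (𝓡 b) π p w) := by
  obtain ⟨C, hC, hlift⟩ := exists_bounded_lift h.contMDiff h.surjective gM gB
  obtain ⟨L, hL, hfL⟩ := exists_length_mfderiv_le gM gM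
    (f.contMDiff.of_le (by exact_mod_cast le_top))
  have hδ := h.δ_nonneg
  have hpos : 0 < 1 - δ * c := sub_pos.2 h.mul_lt_one
  -- This `K` is the fixed point of `K = C (1 + δ L) + K δ c`, the recursion produced by the
  -- estimate below. It exceeds the lifting constant `C`, so bounded lifts meet the bound as well.
  have hK : C ≤ C * (1 + δ * L) / (1 - δ * c) := by
    rw [le_div_iff₀ hpos]
    refine mul_le_mul_of_nonneg_left ?_ hC
    have h1 : 0 ≤ δ * L := by positivity
    have h2 : 0 ≤ δ * c := mul_nonneg hδ h.c_pos.le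
    linarith
  set K := C * (1 + δ * L) / (1 - δ * c) with hK_def
  have hKeq : C * (1 + δ * L) = K - K * (δ * c) := by
    rw [hK_def]; field_simp
  refine ⟨K, hC.trans hK, fun p v => ?_, fun p w hw hle => ?_⟩
  · obtain ⟨w, hw, hle⟩ := hlift p v
    exact ⟨w, hw, hle.trans (mul_le_mul_of_nonneg_right hK (gB.length_nonneg _ _))⟩
  · set v := mfderiv (𝓡 m) (𝓡 b) π p w with hv_def
    -- Split `w` into a bounded lift `u` of `v` and the vertical vector `w - u`, whose length is
    -- controlled by that of its image.
    obtain ⟨u, hu, hule⟩ := hlift p v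
    have hz : mfderiv (𝓡 m) (𝓡 b) π p (w - u) = 0 := by rw [map_sub, hu, sub_self]
    have h1 := h.vertical_le p (w - u) hz
    rw [map_sub] at h1
    have h2 := gM.length_sub_le (f p) (mfderiv (𝓡 m) (𝓡 m) f p w) (mfderiv (𝓡 m) (𝓡 m) f p u)
    have h3 := hfL p u
    have h4 := h.contract (π p) v hw
    have h5 : gM.length p w ≤ gM.length p (w - u) + gM.length p u := by
      have := gM.length_add_le p (w - u) u
      rwa [sub_add_cancel] at this
    have hv0 := gB.length_nonneg (π p) v
    have h6 : gM.length (f p) (mfderiv (𝓡 m) (𝓡 m) f p w) ≤ K * (c * gB.length (π p) v) :=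
      hle.trans (mul_le_mul_of_nonneg_left h4 (hC.trans hK))
    have h7 : gM.length (f p) (mfderiv (𝓡 m) (𝓡 m) f p u) ≤ L * (C * gB.length (π p) v) :=
      h3.trans (mul_le_mul_of_nonneg_left hule hL)
    have h8 := h1.trans (mul_le_mul_of_nonneg_left (h2.trans (add_le_add h6 h7)) hδ)
    calc gM.length p w ≤ δ * (K * (c * gB.length (π p) v) + L * (C * gB.length (π p) v)) +
          C * gB.length (π p) v := h5.trans (add_le_add h8 hule)
      _ = (C * (1 + δ * L) + K * (δ * c)) * gB.length (π p) v := by ring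
      _ = K * gB.length (π p) v := by rw [hKeq, sub_add_cancel]

end IsDominatedLift

end Dominated
end

/-! ### Existence, invariance and continuity of the contracting field -/

noncomputable section
open Filter Set

section ContractingField

variable {m b : ℕ}
  {M : Type*} [TopologicalSpace M] [ChartedSpace (EuclideanSpace ℝ (Fin m)) M]
  [IsManifold (𝓡 m) ∞ M]
  {B : Type*} [TopologicalSpace B] [ChartedSpace (EuclideanSpace ℝ (Fin b)) B]
  [IsManifold (𝓡 b) ∞ B]

instance (x : M) : T2Space (TangentSpace (𝓡 m) x) :=
  inferInstanceAs (T2Space (EuclideanSpace ℝ (Fin m)))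

namespace IsDominatedLift

variable {gM : SmoothMetric m M} {gB : SmoothMetric b B} {π : M → B}
  {f : M ≃ₘ^∞⟮𝓡 m, 𝓡 m⟯ M} {fbar : B ≃ₘ^1⟮𝓡 b, 𝓡 b⟯ B} {E : PlaneField b B} {δ c : ℝ}

/-- Every vector in `E` has a lift to `TM` whose orbit stays comparable to the orbit below. -/
theorem exists_lift (h : IsDominatedLift gM gB π f fbar E δ c) [CompactSpace M] :
    ∃ K : ℝ, 0 ≤ K ∧ ∀ p, ∀ v ∈ E (π p), ∃ w : TangentSpace (𝓡 m) p,
      mfderiv (𝓡 m) (𝓡 b) π p w = v ∧ ∀ k : ℕ,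
      gM.length ((tangentMap (𝓡 m) (𝓡 m) f)^[k] ⟨p, w⟩).1
        ((tangentMap (𝓡 m) (𝓡 m) f)^[k] ⟨p, w⟩).2 ≤
      K * gB.length ((tangentMap (𝓡 b) (𝓡 b) fbar)^[k] ⟨π p, v⟩).1
        ((tangentMap (𝓡 b) (𝓡 b) fbar)^[k] ⟨π p, v⟩).2 := by
  obtain ⟨K, hK, hlift, hstep⟩ := h.exists_length_le_of_tangentMap
  have hlift' : ∀ (q : M) (β : TangentBundle (𝓡 b) B), β.1 = π q →
      ∃ w : TangentBundle (𝓡 m) M, w.1 = q ∧ tangentMap (𝓡 m) (𝓡 b) π w = β ∧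
        gM.length w.1 w.2 ≤ K * gB.length β.1 β.2 := by
    rintro q ⟨y, v⟩ hy
    obtain rfl : y = π q := hy
    obtain ⟨w, hw, hle⟩ := hlift q v
    exact ⟨⟨q, w⟩, rfl, by simp only [tangentMap, hw], hle⟩
  have hstep' : ∀ w : TangentBundle (𝓡 m) M,
      (tangentMap (𝓡 m) (𝓡 b) π w).2 ∈ E (tangentMap (𝓡 m) (𝓡 b) π w).1 →
      gM.length (tangentMap (𝓡 m) (𝓡 m) f w).1 (tangentMap (𝓡 m) (𝓡 m) f w).2 ≤
        K * gB.length
          (tangentMap (𝓡 b) (𝓡 b) fbar (tangentMap (𝓡 m) (𝓡 b) π w)).1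
          (tangentMap (𝓡 b) (𝓡 b) fbar (tangentMap (𝓡 m) (𝓡 b) π w)).2 →
      gM.length w.1 w.2 ≤ K * gB.length (tangentMap (𝓡 m) (𝓡 b) π w).1
        (tangentMap (𝓡 m) (𝓡 b) π w).2 := fun w hw hle => hstep w.1 w.2 hw hle
  refine ⟨K, hK, fun p v hv => ?_⟩
  -- Lifts of `v` satisfying the bound at time `k` only. The backward step makes these sets
  -- decrease, so a common point satisfies the bound at all times.
  let X : ℕ → Set (TangentSpace (𝓡 m) p) := fun k => {w | mfderiv (𝓡 m) (𝓡 b) π p w = v ∧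
    gM.length ((tangentMap (𝓡 m) (𝓡 m) f)^[k] ⟨p, w⟩).1
        ((tangentMap (𝓡 m) (𝓡 m) f)^[k] ⟨p, w⟩).2 ≤
      K * gB.length ((tangentMap (𝓡 b) (𝓡 b) fbar)^[k] ⟨π p, v⟩).1
        ((tangentMap (𝓡 b) (𝓡 b) fbar)^[k] ⟨π p, v⟩).2}
  have hcl : ∀ k, IsClosed (X k) := by
    intro k
    have h1 : Continuous fun w : TangentSpace (𝓡 m) p =>
        gM.length ((tangentMap (𝓡 m) (𝓡 m) f)^[k] ⟨p, w⟩).1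
          ((tangentMap (𝓡 m) (𝓡 m) f)^[k] ⟨p, w⟩).2 :=
      gM.continuous_length.comp (((f.contMDiff.continuous_tangentMap (by simp)).iterate k).comp
        (FiberBundle.continuous_totalSpaceMk (EuclideanSpace ℝ (Fin m)) _ p))
    have h2 := isClosed_le h1 (continuous_const
      (y := K * gB.length ((tangentMap (𝓡 b) (𝓡 b) fbar)^[k] ⟨π p, v⟩).1
        ((tangentMap (𝓡 b) (𝓡 b) fbar)^[k] ⟨π p, v⟩).2))
    have h3 : IsClosed {w | mfderiv (𝓡 m) (𝓡 b) π p w = v} :=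
      isClosed_eq (mfderiv (𝓡 m) (𝓡 b) π p).continuous continuous_const
    exact h3.inter h2
  have hX0 : IsCompact (X 0) :=
    (isCompact_setOf_length_le gM p (K * gB.length (π p) v)).of_isClosed_subset (hcl 0)
      fun w hw => hw.2
  have hanti : ∀ k, X (k + 1) ⊆ X k := by
    rintro k w ⟨hw, hle⟩
    refine ⟨hw, ?_⟩
    have h1 : tangentMap (𝓡 m) (𝓡 b) π ⟨p, w⟩ = ⟨π p, v⟩ := by simp only [tangentMap, hw]
    have h2 := h.tangentMap_iterate_cover k ⟨p, w⟩
    rw [h1] at h2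
    have h3 := hstep' ((tangentMap (𝓡 m) (𝓡 m) f)^[k] ⟨p, w⟩)
    rw [h2] at h3
    rw [Function.iterate_succ_apply', Function.iterate_succ_apply'] at hle
    exact h3 (h.mem_iterate (v := ⟨π p, v⟩) hv k) hle
  -- Take a bounded lift of the `k`-th iterate of `v` at `f^[k] p` and pull it back to `p`.
  have hne : ∀ k, (X k).Nonempty := by
    intro k
    obtain ⟨w', hw'1, hw'2, hw'3⟩ := hlift' (f^[k] p)
      ((tangentMap (𝓡 b) (𝓡 b) fbar)^[k] ⟨π p, v⟩)
      (by
        rw [tangentMap_iterate_fst]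
        exact (Function.Semiconj.iterate_right (f := π) h.cover k p).symm)
    have hsurj : Function.Surjective (tangentMap (𝓡 m) (𝓡 m) f) :=
      Function.RightInverse.surjective (diffeomorph_tangentMap_apply_symm (by simp) f)
    obtain ⟨⟨q, w⟩, hw⟩ := hsurj.iterate k w'
    obtain rfl : q = p := by
      apply f.injective.iterate k
      have := tangentMap_iterate_fst f k (⟨q, w⟩ : TangentBundle (𝓡 m) M)
      rw [hw, hw'1] at this
      exact this.symm
    refine ⟨w, ?_, ?_⟩
    · have h1 := h.tangentMap_iterate_cover k ⟨q, w⟩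
      rw [hw, hw'2] at h1
      have hinj : Function.Injective (tangentMap (𝓡 b) (𝓡 b) fbar) :=
        Function.LeftInverse.injective (diffeomorph_tangentMap_symm_apply le_rfl fbar)
      have h2 := hinj.iterate k h1
      simpa [tangentMap] using h2.symm
    · rw [hw]
      exact hw'3
  obtain ⟨w, hw⟩ := IsCompact.nonempty_iInter_of_sequence_nonempty_isCompact_isClosed X hanti hne
    hX0 hcl
  rw [mem_iInter] at hw
  exact ⟨w, (hw 0).1, fun k => (hw k).2⟩

/-- With `K` fixed the hypothesis on the orbit is closed under limits, which the definition of the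
field does not show by itself. -/
theorem mem_contractingField_of_le (h : IsDominatedLift gM gB π f fbar E δ c) {K : ℝ} (hK : 0 ≤ K)
    {p : M} {w : TangentSpace (𝓡 m) p} (hE : mfderiv (𝓡 m) (𝓡 b) π p w ∈ E (π p))
    (hw : ∀ k : ℕ, gM.length ((tangentMap (𝓡 m) (𝓡 m) f)^[k] ⟨p, w⟩).1
        ((tangentMap (𝓡 m) (𝓡 m) f)^[k] ⟨p, w⟩).2 ≤
      K * gB.length
        ((tangentMap (𝓡 b) (𝓡 b) fbar)^[k] (tangentMap (𝓡 m) (𝓡 b) π ⟨p, w⟩)).1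
        ((tangentMap (𝓡 b) (𝓡 b) fbar)^[k] (tangentMap (𝓡 m) (𝓡 b) π ⟨p, w⟩)).2) :
    w ∈ contractingField gM π f E c p := by
  refine ⟨hE, K * gB.length (π p) (mfderiv (𝓡 m) (𝓡 b) π p w), fun k => (hw k).trans ?_⟩
  rw [mul_assoc, mul_comm (gB.length _ _)]
  exact mul_le_mul_of_nonneg_left
    (h.length_iterate_le (v := tangentMap (𝓡 m) (𝓡 b) π ⟨p, w⟩) hE k) hK

theorem eq_of_mem_contractingField (h : IsDominatedLift gM gB π f fbar E δ c)
    {p : M} {w w' : TangentSpace (𝓡 m) p} (hw : w ∈ contractingField gM π f E c p)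
    (hw' : w' ∈ contractingField gM π f E c p)
    (heq : mfderiv (𝓡 m) (𝓡 b) π p w = mfderiv (𝓡 m) (𝓡 b) π p w') : w = w' :=
  sub_eq_zero.1 (h.eq_zero_of_mem_contractingField (sub_mem hw hw')
    (by rw [map_sub, heq, sub_self]))

/-- The contracting field projects isomorphically onto `E`, and its vectors are uniformly controlled
by their projections along the whole orbit. -/
theorem exists_contractingField_bound (h : IsDominatedLift gM gB π f fbar E δ c) [CompactSpace M] :
    ∃ K : ℝ, 0 ≤ K ∧
      (∀ p, ∀ v ∈ E (π p), ∃ w ∈ contractingField gM π f E c p,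
        mfderiv (𝓡 m) (𝓡 b) π p w = v) ∧
      ∀ p, ∀ w ∈ contractingField gM π f E c p, ∀ k : ℕ,
      gM.length ((tangentMap (𝓡 m) (𝓡 m) f)^[k] ⟨p, w⟩).1
        ((tangentMap (𝓡 m) (𝓡 m) f)^[k] ⟨p, w⟩).2 ≤
      K * gB.length
        ((tangentMap (𝓡 b) (𝓡 b) fbar)^[k] (tangentMap (𝓡 m) (𝓡 b) π ⟨p, w⟩)).1
        ((tangentMap (𝓡 b) (𝓡 b) fbar)^[k] (tangentMap (𝓡 m) (𝓡 b) π ⟨p, w⟩)).2 := by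
  obtain ⟨K, hK, hex⟩ := h.exists_lift
  have hex' : ∀ p, ∀ v ∈ E (π p), ∃ w ∈ contractingField gM π f E c p,
      mfderiv (𝓡 m) (𝓡 b) π p w = v ∧ ∀ k : ℕ,
      gM.length ((tangentMap (𝓡 m) (𝓡 m) f)^[k] ⟨p, w⟩).1
        ((tangentMap (𝓡 m) (𝓡 m) f)^[k] ⟨p, w⟩).2 ≤
      K * gB.length
        ((tangentMap (𝓡 b) (𝓡 b) fbar)^[k] (tangentMap (𝓡 m) (𝓡 b) π ⟨p, w⟩)).1
        ((tangentMap (𝓡 b) (𝓡 b) fbar)^[k] (tangentMap (𝓡 m) (𝓡 b) π ⟨p, w⟩)).2 := by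
    intro p v hv
    obtain ⟨w, rfl, hle⟩ := hex p v hv
    exact ⟨w, h.mem_contractingField_of_le hK hv hle, rfl, hle⟩
  refine ⟨K, hK, fun p v hv => ?_, fun p w hw => ?_⟩
  · obtain ⟨w, hw, hwv, -⟩ := hex' p v hv
    exact ⟨w, hw, hwv⟩
  -- By uniqueness every member equals the lift just constructed and inherits its constant.
  · obtain ⟨w', hw', heq, hle⟩ := hex' p _ hw.1
    rwa [h.eq_of_mem_contractingField hw' hw heq] at hle

theorem isDInvariant_contractingField (h : IsDominatedLift gM gB π f fbar E δ c) :
    IsDInvariant f (contractingField gM π f E c) := by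
  have hE : ∀ p (w : TangentSpace (𝓡 m) p),
      mfderiv (𝓡 m) (𝓡 b) π (f p) (mfderiv (𝓡 m) (𝓡 m) f p w) ∈ E (π (f p)) ↔
        mfderiv (𝓡 m) (𝓡 b) π p w ∈ E (π p) := by
    intro p w
    have h1 := h.mem_tangentMap_iff (tangentMap (𝓡 m) (𝓡 b) π ⟨p, w⟩)
    rw [← h.tangentMap_cover] at h1
    exact h1
  intro p
  apply le_antisymm
  · rintro _ ⟨w, ⟨hw, C, hC⟩, rfl⟩
    refine ⟨(hE p w).2 hw, C * c, fun k => ?_⟩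
    rw [mul_assoc, ← pow_succ']
    exact hC (k + 1)
  · intro w' hw'
    obtain ⟨w, rfl⟩ := diffeomorph_mfderiv_surjective (by simp) f p w'
    obtain ⟨hw, C, hC⟩ := hw'
    -- Shifting the orbit by one costs a factor `c`. The second entry of the maximum covers time
    -- `0`, which the orbit of `Df w` does not see.
    refine ⟨w, ⟨(hE p w).1 hw, max (C / c) (gM.length p w), fun k => ?_⟩, rfl⟩
    cases k with
    | zero => simp
    | succ k =>
      refine (hC k).trans ?_
      rw [pow_succ', ← mul_assoc]
      refine mul_le_mul_of_nonneg_right ?_ (pow_nonneg h.c_pos.le k)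
      rw [← div_le_iff₀ h.c_pos]
      exact le_max_left _ _

/-- A closed graph argument: the lifts of a local frame of `E` are locally bounded, every limit of
them satisfies the same orbit bounds over the limiting frame vector, and uniqueness leaves only one
candidate. -/
theorem isContinuousSubbundle_contractingField (h : IsDominatedLift gM gB π f fbar E δ c)
    [CompactSpace M] [T2Space M] [T2Space B] :
    IsContinuousSubbundle (contractingField gM π f E c) := by
  obtain ⟨K, hK, hex, hbd⟩ := h.exists_contractingField_bound
  have : T2Space (TangentBundle (𝓡 b) B) := tangentBundle_t2Space
  have hTf : Continuous (tangentMap (𝓡 m) (𝓡 m) f) := f.contMDiff.continuous_tangentMap (by simp)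
  have hTfbar : Continuous (tangentMap (𝓡 b) (𝓡 b) fbar) :=
    fbar.contMDiff.continuous_tangentMap le_rfl
  have hTπ : Continuous (tangentMap (𝓡 m) (𝓡 b) π) := h.contMDiff.continuous_tangentMap le_rfl
  intro p₀
  obtain ⟨r, U, s, hU, hx₀, hs, hspan⟩ := h.subbundle (π p₀)
  have hsE : ∀ x ∈ U, ∀ i, s i x ∈ E x := fun x hx i => by
    rw [← (hspan x hx).2]; exact Submodule.subset_span (mem_range_self i)
  -- Stated as an implication so that `choose` yields sections on all of `M`; off `π ⁻¹' U` their
  -- values are irrelevant.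
  have hσ : ∀ i p, ∃ w : TangentSpace (𝓡 m) p, π p ∈ U →
      w ∈ contractingField gM π f E c p ∧ mfderiv (𝓡 m) (𝓡 b) π p w = s i (π p) := by
    intro i p
    by_cases hp : π p ∈ U
    · obtain ⟨w, hw, hw'⟩ := hex p _ (hsE _ hp i)
      exact ⟨w, fun _ => ⟨hw, hw'⟩⟩
    · exact ⟨0, fun hp' => absurd hp' hp⟩
  choose σ hσ using hσ
  refine ⟨r, π ⁻¹' U, σ, hU.preimage h.contMDiff.continuous, hx₀, fun i p hp => ?_,
    fun p hp => ?_⟩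
  · have hβ : ContinuousWithinAt (fun q => (⟨π q, s i (π q)⟩ : TangentBundle (𝓡 b) B))
        (π ⁻¹' U) p :=
      ContinuousWithinAt.comp (g := fun x => (⟨x, s i x⟩ : TangentBundle (𝓡 b) B))
        (hs i (π p) hp) h.contMDiff.continuous.continuousWithinAt (fun q hq => hq)
    refine (tendsto_iff_ultrafilter _ _ _).2 fun u hu => ?_
    have hu' : ∀ᶠ q in u, q ∈ π ⁻¹' U := hu self_mem_nhdsWithin
    have hup : Tendsto id (u : Filter M) (𝓝 p) := hu.trans nhdsWithin_le_nhds
    have hβu := hβ.tendsto.mono_left hu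
    have hTπeq : ∀ q ∈ π ⁻¹' U, tangentMap (𝓡 m) (𝓡 b) π ⟨q, σ i q⟩ = ⟨π q, s i (π q)⟩ := by
      intro q hq
      simp only [tangentMap, (hσ i q hq).2]
    have hbdd : ∀ᶠ q in u, (⟨q, σ i q⟩ : TangentBundle (𝓡 m) M) ∈
        {w : TangentBundle (𝓡 m) M | gM.length w.1 w.2 ≤
          K * (gB.length (π p) (s i (π p)) + 1)} := by
      have h1 : ∀ᶠ q in u, gB.length (π q) (s i (π q)) < gB.length (π p) (s i (π p)) + 1 :=
        ((gB.continuous_length.tendsto _).comp hβu).eventually_lt_const (lt_add_one _)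
      filter_upwards [hu', h1] with q hq hlt
      have h2 := hbd q (σ i q) (hσ i q hq).1 0
      rw [hTπeq q hq] at h2
      exact h2.trans (mul_le_mul_of_nonneg_left hlt.le hK)
    obtain ⟨⟨p', w⟩, -, hlim⟩ := (gM.isCompact_length_le _).ultrafilter_le_nhds
      (u.map fun q => (⟨q, σ i q⟩ : TangentBundle (𝓡 m) M)) (le_principal_iff.2 hbdd)
    have hlim : Tendsto (fun q => (⟨q, σ i q⟩ : TangentBundle (𝓡 m) M)) u (𝓝 ⟨p', w⟩) := hlim
    obtain rfl : p' = p := tendsto_nhds_unique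
      (((FiberBundle.continuous_proj (EuclideanSpace ℝ (Fin m))
        (TangentSpace (𝓡 m) : M → Type)).tendsto _).comp hlim) hup
    have h1 : tangentMap (𝓡 m) (𝓡 b) π ⟨p', w⟩ = ⟨π p', s i (π p')⟩ :=
      tendsto_nhds_unique (((hTπ.tendsto _).comp hlim).congr' (hu'.mono hTπeq)) hβu
    have h2 : mfderiv (𝓡 m) (𝓡 b) π p' w = s i (π p') := by simpa [tangentMap] using h1
    -- For each fixed `k` both sides of the orbit bound are continuous on the tangent bundle, so the
    -- bound survives the limit.
    have h3 : w ∈ contractingField gM π f E c p' := by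
      refine h.mem_contractingField_of_le hK (by rw [h2]; exact hsE _ hp i) fun k => ?_
      refine le_of_tendsto_of_tendsto
        (((gM.continuous_length.comp (hTf.iterate k)).tendsto _).comp hlim)
        ((((gB.continuous_length.comp ((hTfbar.iterate k).comp hTπ)).tendsto _).comp
          hlim).const_mul K) ?_
      filter_upwards [hu'] with q hq
      exact hbd q (σ i q) (hσ i q hq).1 k
    rwa [h.eq_of_mem_contractingField h3 (hσ i p' hp).1 (h2.trans (hσ i p' hp).2.symm)] at hlim
  · have hDσ : (fun i => mfderiv (𝓡 m) (𝓡 b) π p (σ i p)) = fun i => s i (π p) :=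
      funext fun i => (hσ i p hp).2
    have hLI := (hspan (π p) hp).1
    rw [← hDσ] at hLI
    refine ⟨LinearIndependent.of_comp (mfderiv (𝓡 m) (𝓡 b) π p).toLinearMap hLI,
      le_antisymm ?_ fun w hw => ?_⟩
    · rw [Submodule.span_le]
      rintro _ ⟨i, rfl⟩
      exact (hσ i p hp).1
    · have h1 := hw.1
      rw [← (hspan (π p) hp).2] at h1
      obtain ⟨α, hα⟩ := (Submodule.mem_span_range_iff_exists_fun ℝ).1 h1
      have h2 : ∑ i, α i • σ i p ∈ contractingField gM π f E c p :=
        Submodule.sum_mem _ fun i _ => Submodule.smul_mem _ _ (hσ i p hp).1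
      have h3 : w = ∑ i, α i • σ i p := by
        refine h.eq_of_mem_contractingField hw h2 ?_
        rw [← hα, map_sum]
        exact Finset.sum_congr rfl fun i _ => by rw [map_smul, (hσ i p hp).2]
      rw [h3]
      exact Submodule.sum_mem _ fun i _ => Submodule.smul_mem _ _
        (Submodule.subset_span (mem_range_self i))

end IsDominatedLift

end ContractingField
end

/-! ### Surjections of a compact connected manifold are not uniform contractions -/

noncomputable section
open Filter Set

section Contraction

variable {n : ℕ} {M : Type*} [TopologicalSpace M] [ChartedSpace (EuclideanSpace ℝ (Fin n)) M]
  [IsManifold (𝓡 n) ∞ M]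

open scoped Bundle in
-- Push a nearly minimal curve forward: its speed, hence its length, is multiplied by at most `c`.
theorem riemannianEDist_map_le (g : SmoothMetric n M) {h : M → M}
    (hh : ContMDiff (𝓡 n) (𝓡 n) 1 h) {c : ℝ} (hc0 : 0 < c)
    (hc : ∀ x (v : TangentSpace (𝓡 n) x),
      g.length (h x) (mfderiv (𝓡 n) (𝓡 n) h x v) ≤ c * g.length x v) (x y : M) :
    let _ : Bundle.RiemannianBundle (fun x : M => TangentSpace (𝓡 n) x) := ⟨g.toRiemannianMetric⟩
    Manifold.riemannianEDist (𝓡 n) (h x) (h y) ≤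
      ENNReal.ofReal c * Manifold.riemannianEDist (𝓡 n) x y := by
  intro _
  have hbound : ∀ x (v : TangentSpace (𝓡 n) x),
      ‖mfderiv (𝓡 n) (𝓡 n) h x v‖ₑ ≤ ENNReal.ofReal c * ‖v‖ₑ := by
    intro x v
    rw [← ofReal_norm, ← ofReal_norm, ← ENNReal.ofReal_mul' (norm_nonneg v)]
    refine ENNReal.ofReal_le_ofReal ?_
    have := hc x v
    rwa [g.length_eq_norm, g.length_eq_norm] at this
  have hpath : ∀ r, Manifold.riemannianEDist (𝓡 n) x y < r →
      Manifold.riemannianEDist (𝓡 n) (h x) (h y) ≤ ENNReal.ofReal c * r := by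
    intro r hr
    obtain ⟨γ, h0, h1, hγ, hlt⟩ := Manifold.exists_lt_of_riemannianEDist_lt hr
    refine (Manifold.riemannianEDist_le_pathELength (γ := h ∘ γ) (a := 0) (b := 1)
      (hh.comp_contMDiffOn hγ) (by simp [h0]) (by simp [h1]) zero_le_one).trans
      (le_trans ?_ (mul_le_mul_right hlt.le _))
    rw [Manifold.pathELength_eq_lintegral_mfderivWithin_Icc,
      Manifold.pathELength_eq_lintegral_mfderivWithin_Icc,
      ← MeasureTheory.lintegral_const_mul' _ _ ENNReal.ofReal_ne_top]
    refine MeasureTheory.setLIntegral_mono' measurableSet_Icc fun t ht => ?_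
    have hu : UniqueMDiffWithinAt 𝓘(ℝ, ℝ) (Icc (0 : ℝ) 1) t :=
      (uniqueDiffOn_Icc_zero_one t ht).uniqueMDiffWithinAt
    rw [mfderiv_comp_mfderivWithin t (hh.mdifferentiableAt one_ne_zero)
      ((hγ t ht).mdifferentiableWithinAt one_ne_zero) hu]
    exact hbound _ _
  have hc0' : ENNReal.ofReal c ≠ 0 := by simpa using hc0
  have key : Manifold.riemannianEDist (𝓡 n) (h x) (h y) / ENNReal.ofReal c ≤
      Manifold.riemannianEDist (𝓡 n) x y := by
    refine le_of_forall_gt_imp_ge_of_dense fun r hr => ?_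
    rw [ENNReal.div_le_iff hc0' ENNReal.ofReal_ne_top, mul_comm]
    exact hpath r hr
  rwa [ENNReal.div_le_iff hc0' ENNReal.ofReal_ne_top, mul_comm] at key

open scoped Bundle in
/-- A surjective map of a compact connected manifold of positive dimension cannot shrink all tangent
vectors uniformly. -/
theorem not_uniform_contraction [CompactSpace M] [T2Space M] [PreconnectedSpace M] [Nonempty M]
    (hn : 0 < n) (g : SmoothMetric n M) {h : M → M} (hh : ContMDiff (𝓡 n) (𝓡 n) 1 h)
    (hsurj : Function.Surjective h) {c : ℝ} (hc0 : 0 < c) (hc1 : c < 1)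
    (hc : ∀ x (v : TangentSpace (𝓡 n) x),
      g.length (h x) (mfderiv (𝓡 n) (𝓡 n) h x v) ≤ c * g.length x v) : False := by
  let : Bundle.RiemannianBundle (fun x : M => TangentSpace (𝓡 n) x) := ⟨g.toRiemannianMetric⟩
  have : IsContinuousRiemannianBundle (EuclideanSpace ℝ (Fin n))
      (fun x : M => TangentSpace (𝓡 n) x) := ⟨g.inner, g.contMDiff.continuous, fun _ _ _ => rfl⟩
  let : EMetricSpace M := EMetricSpace.ofRiemannianMetric (𝓡 n) M
  have hle : ∀ x y, edist (h x) (h y) ≤ ENNReal.ofReal c * edist x y :=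
    riemannianEDist_map_le g hh hc0 hc
  -- A ball of infinite radius is open and closed, hence everything by connectedness.
  have hfin : ∀ x y : M, edist x y < ⊤ := by
    intro x y
    have h1 : Metric.eball y ⊤ = univ := IsClopen.eq_univ
      ⟨Metric.isClosed_eball_top, Metric.isOpen_eball⟩ ⟨y, Metric.mem_eball_self ENNReal.zero_lt_top⟩
    exact Metric.mem_eball.1 (h1 ▸ mem_univ x)
  -- Preimages of a pair at maximal distance would be even farther apart unless that distance is
  -- zero. Then `M` is a point, and a chart makes a singleton open in positive dimension.
  obtain ⟨⟨x, y⟩, -, hmax⟩ := (isCompact_univ (X := M × M)).exists_isMaxOn univ_nonempty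
    (continuous_edist (α := M)).continuousOn
  have hmax' : ∀ a b : M, edist a b ≤ edist x y := fun a b => hmax (mem_univ (a, b))
  have hzero : edist x y = 0 := by
    obtain ⟨x', rfl⟩ := hsurj x
    obtain ⟨y', rfl⟩ := hsurj y
    by_contra hne
    have h1 := (hle x' y').trans (mul_le_mul_right (hmax' x' y') (ENNReal.ofReal c))
    have h2 : ENNReal.ofReal c * edist (h x') (h y') < 1 * edist (h x') (h y') :=
      ENNReal.mul_lt_mul_left hne (hfin _ _).ne (by simpa using hc1)
    rw [one_mul] at h2
    exact (h1.trans_lt h2).false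
  have hsub : ∀ a b : M, a = b := fun a b => edist_le_zero.1 ((hmax' a b).trans hzero.le)
  let e := chartAt (EuclideanSpace ℝ (Fin n)) x
  have hopen : IsOpen ({e x} : Set (EuclideanSpace ℝ (Fin n))) := by
    convert e.open_target using 1
    ext z
    refine ⟨fun hz => ?_, fun hz => ?_⟩
    · rw [mem_singleton_iff.1 hz]
      exact e.map_source (mem_chart_source _ x)
    · rw [mem_singleton_iff, hsub x (e.symm z), e.right_inv hz]
  have : Nonempty (Fin n) := ⟨⟨0, hn⟩⟩
  exact not_isOpen_singleton (e x) hopen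

end Contraction
end

/-! ### Adding a pulled-back metric -/

noncomputable section
open Filter Set

section PullbackMetric

variable {m b : ℕ}
  {M : Type*} [TopologicalSpace M] [ChartedSpace (EuclideanSpace ℝ (Fin m)) M]
  [IsManifold (𝓡 m) ∞ M]
  {B : Type*} [TopologicalSpace B] [ChartedSpace (EuclideanSpace ℝ (Fin b)) B]
  [IsManifold (𝓡 b) ∞ B]

namespace SmoothMetric

/-- The pullback of a metric by a map, a positive semidefinite form. -/
def pullback (gB : SmoothMetric b B) (π : M → B) (p : M) :
    TangentSpace (𝓡 m) p →L[ℝ] TangentSpace (𝓡 m) p →L[ℝ] ℝ :=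
  ((mfderiv (𝓡 m) (𝓡 b) π p).precomp ℝ).comp
    ((gB.inner (π p)).comp (mfderiv (𝓡 m) (𝓡 b) π p))

theorem contMDiff_pullback (gB : SmoothMetric b B) {π : M → B} (hπ : ContMDiff (𝓡 m) (𝓡 b) ∞ π) :
    ContMDiff (𝓡 m) ((𝓡 m).prod 𝓘(ℝ, EuclideanSpace ℝ (Fin m) →L[ℝ] EuclideanSpace ℝ (Fin m) →L[ℝ] ℝ))
      ∞ (fun p : M => Bundle.TotalSpace.mk'
        (EuclideanSpace ℝ (Fin m) →L[ℝ] EuclideanSpace ℝ (Fin m) →L[ℝ] ℝ)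
        (E := fun p : M => TangentSpace (𝓡 m) p →L[ℝ] TangentSpace (𝓡 m) p →L[ℝ] ℝ)
        p (gB.pullback π p)) := by
  intro p₀
  rw [contMDiffAt_hom_bundle]
  refine ⟨contMDiffAt_id, ?_⟩
  have hA : ContMDiffAt (𝓡 m) 𝓘(ℝ, EuclideanSpace ℝ (Fin m) →L[ℝ] EuclideanSpace ℝ (Fin b)) ∞
      (derivCoord m b π p₀) p₀ :=
    ContMDiffAt.mfderiv_const (m := ∞) (n := ∞) (hπ p₀) (by simp)
  have hG := (contMDiffAt_hom_bundle _).1 (gB.contMDiff (π p₀))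
  have hGπ := hG.2.comp p₀ (hπ p₀)
  -- In coordinates the pullback is the Gram form `G (π p)` evaluated on `A p v` and `A p w`, with
  -- `A` the derivative of `π`; all factors are smooth.
  have hcomp := (hA.clm_precomp (F₃ := ℝ)).clm_comp (hGπ.clm_comp hA)
  refine hcomp.congr_of_eventuallyEq ?_
  filter_upwards [(isOpen_derivCoord_domain hπ.continuous p₀).mem_nhds
    (mem_derivCoord_domain (m := m) (b := b) π p₀)] with p hp
  ext v w
  rw [inCoordinates_apply_eq₂ hp.1 hp.1 (mem_univ _)]
  simp only [Function.comp_apply, ContinuousLinearMap.comp_apply, ContinuousLinearMap.precomp_apply]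
  rw [inCoordinates_apply_eq₂ hp.2 hp.2 (mem_univ _)]
  have h1 := fun a => mfderiv_symmL hp a
  have hp2 : π p ∈ (tangentTriv b (π p₀)).baseSet := hp.2
  simp only [Bundle.Trivialization.symmL_apply _ hp.1, Bundle.Trivialization.symmL_apply _ hp2] at h1
  rw [← h1, ← h1]
  rfl

/-- The metric `gM + T • π^* gB`. -/
def addPullback (gM : SmoothMetric m M) (gB : SmoothMetric b B) {π : M → B}
    (hπ : ContMDiff (𝓡 m) (𝓡 b) ∞ π) {T : ℝ} (hT : 0 ≤ T) : SmoothMetric m M where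
  inner p := gM.inner p + T • gB.pullback π p
  symm p v w := by
    have h1 := gM.symm p v w
    have h2 : gB.pullback π p v w = gB.pullback π p w v := gB.symm (π p) _ _
    simp [h1, h2]
  pos p v hv := by
    have h1 := gM.pos p v hv
    have h2 : 0 ≤ gB.pullback π p v v :=
      (sq_nonneg _).trans_eq (gB.sq_length (π p) (mfderiv (𝓡 m) (𝓡 b) π p v))
    have h3 := mul_nonneg hT h2
    simpa using add_pos_of_pos_of_nonneg h1 h3
  isVonNBounded p := by
    -- The new form dominates `gM`, so its unit ball is contained in the old one.
    refine (gM.isVonNBounded p).subset fun v hv => ?_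
    have h2 : 0 ≤ gB.pullback π p v v :=
      (sq_nonneg _).trans_eq (gB.sq_length (π p) (mfderiv (𝓡 m) (𝓡 b) π p v))
    have h3 := mul_nonneg hT h2
    have h4 : gM.inner p v v + T * gB.pullback π p v v < 1 := by simpa using hv
    exact lt_of_le_of_lt (by linarith) h4
  contMDiff := gM.contMDiff.add_section ((contMDiff_pullback gB hπ).const_smul_section (a := T))

theorem sq_length_addPullback (gM : SmoothMetric m M) (gB : SmoothMetric b B) {π : M → B}
    (hπ : ContMDiff (𝓡 m) (𝓡 b) ∞ π) {T : ℝ} (hT : 0 ≤ T) (p : M) (v : TangentSpace (𝓡 m) p) :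
    (gM.addPullback gB hπ hT).length p v ^ 2 =
      gM.length p v ^ 2 + T * gB.length (π p) (mfderiv (𝓡 m) (𝓡 b) π p v) ^ 2 := by
  rw [sq_length, sq_length, sq_length]
  rfl

theorem length_addPullback_of_vertical (gM : SmoothMetric m M) (gB : SmoothMetric b B) {π : M → B}
    (hπ : ContMDiff (𝓡 m) (𝓡 b) ∞ π) {T : ℝ} (hT : 0 ≤ T) {p : M} {v : TangentSpace (𝓡 m) p}
    (hv : mfderiv (𝓡 m) (𝓡 b) π p v = 0) :
    (gM.addPullback gB hπ hT).length p v = gM.length p v := by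
  have h := sq_length_addPullback gM gB hπ hT p v
  rw [hv, length_zero] at h
  exact (pow_left_inj₀ (length_nonneg _ _ _) (length_nonneg _ _ _) two_ne_zero).1 (by simpa using h)

end SmoothMetric

end PullbackMetric
end

/-! ### Norms and conorms, three-fold splittings, rates in the new metric -/

noncomputable section
open Filter Set

section Norms

variable {n : ℕ} {M : Type*} [TopologicalSpace M] [ChartedSpace (EuclideanSpace ℝ (Fin n)) M]
  [IsManifold (𝓡 n) ∞ M] {g : SmoothMetric n M} {f : M → M} {E : PlaneField n M} {x : M} {a : ℝ}

theorem SmoothMetric.length_inv_smul_self (g : SmoothMetric n M) {v : TangentSpace (𝓡 n) x}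
    (hv : v ≠ 0) : g.length x ((g.length x v)⁻¹ • v) = 1 := by
  rw [g.length_smul, abs_of_pos (inv_pos.2 (g.length_pos hv)), inv_mul_cancel₀ (g.length_pos hv).ne']

theorem length_mfderiv_inv_smul_self {v : TangentSpace (𝓡 n) x} (hv : v ≠ 0) :
    g.length (f x) (mfderiv (𝓡 n) (𝓡 n) f x ((g.length x v)⁻¹ • v)) =
      g.length (f x) (mfderiv (𝓡 n) (𝓡 n) f x v) / g.length x v := by
  rw [map_smul, g.length_smul, abs_of_pos (inv_pos.2 (g.length_pos hv)), inv_mul_eq_div]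

theorem ofReal_le_normOn {v : TangentSpace (𝓡 n) x} (hv : v ∈ E x) (hv0 : v ≠ 0) :
    ENNReal.ofReal (g.length (f x) (mfderiv (𝓡 n) (𝓡 n) f x v) / g.length x v) ≤
      normOn g f E x := by
  rw [← length_mfderiv_inv_smul_self hv0]
  exact le_iSup (fun v : {v : TangentSpace (𝓡 n) x // v ∈ E x ∧ g.length x v = 1} =>
    ENNReal.ofReal (g.length (f x) (mfderiv (𝓡 n) (𝓡 n) f x v.1)))
    ⟨(g.length x v)⁻¹ • v, Submodule.smul_mem _ _ hv, g.length_inv_smul_self hv0⟩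

theorem conormOn_le_ofReal {v : TangentSpace (𝓡 n) x} (hv : v ∈ E x) (hv0 : v ≠ 0) :
    conormOn g f E x ≤
      ENNReal.ofReal (g.length (f x) (mfderiv (𝓡 n) (𝓡 n) f x v) / g.length x v) := by
  rw [← length_mfderiv_inv_smul_self hv0]
  exact iInf_le (fun v : {v : TangentSpace (𝓡 n) x // v ∈ E x ∧ g.length x v = 1} =>
    ENNReal.ofReal (g.length (f x) (mfderiv (𝓡 n) (𝓡 n) f x v.1)))
    ⟨(g.length x v)⁻¹ • v, Submodule.smul_mem _ _ hv, g.length_inv_smul_self hv0⟩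

/-- Any unit vector of `E x` sits between the two. On the zero space the conorm is `∞` and the norm
is `0`. -/
theorem conormOn_le_normOn (hE : E x ≠ ⊥) : conormOn g f E x ≤ normOn g f E x := by
  obtain ⟨v, hv, hv0⟩ := (Submodule.ne_bot_iff _).1 hE
  exact (conormOn_le_ofReal hv hv0).trans (ofReal_le_normOn hv hv0)

theorem length_le_of_normOn_le (ha : 0 ≤ a) (h : normOn g f E x ≤ ENNReal.ofReal a)
    {v : TangentSpace (𝓡 n) x} (hv : v ∈ E x) :
    g.length (f x) (mfderiv (𝓡 n) (𝓡 n) f x v) ≤ a * g.length x v := by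
  rcases eq_or_ne v 0 with rfl | hv0
  · simp
  rw [← div_le_iff₀ (g.length_pos hv0)]
  exact (ENNReal.ofReal_le_ofReal_iff ha).1 ((ofReal_le_normOn hv hv0).trans h)

theorem length_lt_of_normOn_lt (h : normOn g f E x < ENNReal.ofReal a)
    {v : TangentSpace (𝓡 n) x} (hv : v ∈ E x) (hv0 : v ≠ 0) :
    g.length (f x) (mfderiv (𝓡 n) (𝓡 n) f x v) < a * g.length x v := by
  rw [← div_lt_iff₀ (g.length_pos hv0)]
  exact (ENNReal.ofReal_lt_ofReal_iff_of_nonneg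
    (div_nonneg (g.length_nonneg _ _) (g.length_nonneg _ _))).1 ((ofReal_le_normOn hv hv0).trans_lt h)

theorem lt_length_of_lt_conormOn (ha : 0 ≤ a) (h : ENNReal.ofReal a < conormOn g f E x)
    {v : TangentSpace (𝓡 n) x} (hv : v ∈ E x) (hv0 : v ≠ 0) :
    a * g.length x v < g.length (f x) (mfderiv (𝓡 n) (𝓡 n) f x v) := by
  rw [← lt_div_iff₀ (g.length_pos hv0)]
  exact (ENNReal.ofReal_lt_ofReal_iff_of_nonneg ha).1 (h.trans_le (conormOn_le_ofReal hv hv0))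

theorem normOn_le_ofReal (h : ∀ v ∈ E x,
    g.length (f x) (mfderiv (𝓡 n) (𝓡 n) f x v) ≤ a * g.length x v) :
    normOn g f E x ≤ ENNReal.ofReal a := by
  refine iSup_le fun v => ENNReal.ofReal_le_ofReal ?_
  simpa [v.2.2] using h v.1 v.2.1

theorem ofReal_le_conormOn (h : ∀ v ∈ E x,
    a * g.length x v ≤ g.length (f x) (mfderiv (𝓡 n) (𝓡 n) f x v)) :
    ENNReal.ofReal a ≤ conormOn g f E x := by
  refine le_iInf fun v => ENNReal.ofReal_le_ofReal ?_
  simpa [v.2.2] using h v.1 v.2.1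

end Norms

section Invariance

variable {n : ℕ} {M : Type*} [TopologicalSpace M] [ChartedSpace (EuclideanSpace ℝ (Fin n)) M]
  {k : ℕ∞ω} {f : M ≃ₘ^k⟮𝓡 n, 𝓡 n⟯ M} {E : PlaneField n M}

/-- If the inverse of `f` shrinks the vectors of an invariant field, then `f` stretches them. -/
theorem le_length_of_symm_le [IsManifold (𝓡 n) ∞ M] (hk : 1 ≤ k) {g : SmoothMetric n M} {c : ℝ}
    (hE : IsDInvariant f E) (h : ∀ x, ∀ v ∈ E x,
      g.length (f.symm x) (mfderiv (𝓡 n) (𝓡 n) f.symm x v) ≤ c * g.length x v)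
    {x : M} {v : TangentSpace (𝓡 n) x} (hv : v ∈ E x) :
    g.length x v ≤ c * g.length (f x) (mfderiv (𝓡 n) (𝓡 n) f x v) := by
  have h1 := h (f x) _ (((isDInvariant_iff hk).1 hE ⟨x, v⟩).2 hv)
  have h2 := congrArg (fun w : TangentBundle (𝓡 n) M => g.length w.1 w.2)
    (diffeomorph_tangentMap_symm_apply hk f ⟨x, v⟩)
  exact h2.symm.trans_le h1

/-- A local frame has a fixed number of members, and the fiber vanishes exactly when that number is
zero. -/
theorem IsContinuousSubbundle.isLocallyConstant_eq_bot [IsManifold (𝓡 n) 1 M]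
    (hE : IsContinuousSubbundle E) : IsLocallyConstant fun x => E x = ⊥ := by
  rw [IsLocallyConstant.iff_eventually_eq]
  intro x₀
  obtain ⟨r, U, s, hU, hx₀, -, hs⟩ := hE x₀
  have key : ∀ x ∈ U, (E x = ⊥) = (r = 0) := by
    intro x hx
    rw [← (hs x hx).2, eq_iff_iff, Submodule.span_eq_bot]
    constructor
    · intro h
      by_contra hr
      exact (hs x hx).1.ne_zero ⟨0, Nat.pos_of_ne_zero hr⟩ (h _ (mem_range_self _))
    · rintro rfl _ ⟨i, -⟩
      exact i.elim0
  filter_upwards [hU.mem_nhds hx₀] with x hx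
  rw [key x hx, key x₀ hx₀]

end Invariance

section LinearAlgebra

/-- `S` and `U` map isomorphically onto complementary subspaces. Independence is tested after
applying `D`; for spanning, subtract lifts of the two components of `D x`, which leaves an element
of the kernel. -/
theorem isInternal_of_isCompl {V W : Type*} [AddCommGroup V] [Module ℝ V] [AddCommGroup W]
    [Module ℝ W] (D : V →ₗ[ℝ] W) {S U : Submodule ℝ V} {S' U' : Submodule ℝ W}
    (hc : IsCompl S' U') (hS : ∀ v ∈ S, D v ∈ S') (hU : ∀ v ∈ U, D v ∈ U')
    (hS0 : ∀ v ∈ S, D v = 0 → v = 0) (hU0 : ∀ v ∈ U, D v = 0 → v = 0)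
    (hSs : ∀ w ∈ S', ∃ v ∈ S, D v = w) (hUs : ∀ w ∈ U', ∃ v ∈ U, D v = w) :
    DirectSum.IsInternal ![S, LinearMap.ker D, U] := by
  have hd := Submodule.disjoint_def.1 hc.disjoint
  have h0 : Disjoint S (LinearMap.ker D ⊔ U) := by
    refine Submodule.disjoint_def.2 fun x hx hx' => ?_
    obtain ⟨v, hv, u, hu, rfl⟩ := Submodule.mem_sup.1 hx'
    refine hS0 _ hx (hd _ (hS _ hx) ?_)
    rw [map_add, LinearMap.mem_ker.1 hv, zero_add]
    exact hU u hu
  have h1 : Disjoint (LinearMap.ker D) (S ⊔ U) := by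
    refine Submodule.disjoint_def.2 fun x hx hx' => ?_
    obtain ⟨s, hs, u, hu, rfl⟩ := Submodule.mem_sup.1 hx'
    have h0 : D s + D u = 0 := by rw [← map_add]; exact LinearMap.mem_ker.1 hx
    have h1 : D s = 0 := by
      refine hd _ (hS s hs) ?_
      rw [eq_neg_of_add_eq_zero_left h0]
      exact neg_mem (hU u hu)
    rw [h1, zero_add] at h0
    rw [hS0 s hs h1, hU0 u hu h0, add_zero]
  have h2 : Disjoint U (S ⊔ LinearMap.ker D) := by
    refine Submodule.disjoint_def.2 fun x hx hx' => ?_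
    obtain ⟨s, hs, v, hv, rfl⟩ := Submodule.mem_sup.1 hx'
    refine hU0 _ hx (hd _ ?_ (hU _ hx))
    rw [map_add, LinearMap.mem_ker.1 hv, add_zero]
    exact hS s hs
  rw [DirectSum.isInternal_submodule_iff_iSupIndep_and_iSup_eq_top]
  constructor
  · rw [iSupIndep_def]
    intro i
    fin_cases i
    · refine h0.mono_right (iSup₂_le fun j hj => ?_)
      fin_cases j
      exacts [absurd rfl hj, le_sup_left, le_sup_right]
    · refine h1.mono_right (iSup₂_le fun j hj => ?_)
      fin_cases j
      exacts [le_sup_left, absurd rfl hj, le_sup_right]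
    · refine h2.mono_right (iSup₂_le fun j hj => ?_)
      fin_cases j
      exacts [le_sup_left, le_sup_right, absurd rfl hj]
  · rw [eq_top_iff]
    intro x _
    obtain ⟨a, ha, e, he, hae⟩ := Submodule.mem_sup.1
      (hc.sup_eq_top ▸ Submodule.mem_top : D x ∈ S' ⊔ U')
    obtain ⟨s, hs, rfl⟩ := hSs a ha
    obtain ⟨u, hu, rfl⟩ := hUs e he
    have hk : x - s - u ∈ LinearMap.ker D := by
      rw [LinearMap.mem_ker, map_sub, map_sub, ← hae]
      abel
    have hmem : ∀ (i : Fin 3) (y : V), y ∈ (![S, LinearMap.ker D, U] : Fin 3 → Submodule ℝ V) i →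
        y ∈ ⨆ i, (![S, LinearMap.ker D, U] : Fin 3 → Submodule ℝ V) i :=
      fun i y hy => Submodule.mem_iSup_of_mem i hy
    have hx : x = s + (x - s - u) + u := by abel
    rw [hx]
    exact add_mem (add_mem (hmem 0 s hs) (hmem 1 _ hk)) (hmem 2 u hu)

end LinearAlgebra

section Metric

variable {m b : ℕ}
  {M : Type*} [TopologicalSpace M] [ChartedSpace (EuclideanSpace ℝ (Fin m)) M]
  [IsManifold (𝓡 m) ∞ M]
  {B : Type*} [TopologicalSpace B] [ChartedSpace (EuclideanSpace ℝ (Fin b)) B]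
  [IsManifold (𝓡 b) ∞ B]
  {gM : SmoothMetric m M} {gB : SmoothMetric b B} {π : M → B}
  {f : M ≃ₘ^∞⟮𝓡 m, 𝓡 m⟯ M} {fbar : B ≃ₘ^1⟮𝓡 b, 𝓡 b⟯ B} {E : PlaneField b B} {δ c : ℝ}

/-- In the metric `gM + T • π^* gB` with large `T` the contraction rate of `f` on the contracting
field is as close as desired to the contraction rate of `fbar` on `E`. -/
theorem IsDominatedLift.exists_length_addPullback_le (h : IsDominatedLift gM gB π f fbar E δ c)
    [CompactSpace M] (hπ : ContMDiff (𝓡 m) (𝓡 b) ∞ π) {c' : ℝ} (hc : c < c') :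
    ∃ T₀ : ℝ, ∀ T, ∀ hT : 0 ≤ T, T₀ ≤ T → ∀ p, ∀ w ∈ contractingField gM π f E c p,
      (gM.addPullback gB hπ hT).length (f p) (mfderiv (𝓡 m) (𝓡 m) f p w) ≤
        c' * (gM.addPullback gB hπ hT).length p w := by
  obtain ⟨K, hK, -, hbd⟩ := h.exists_contractingField_bound
  have hc0 := h.c_pos
  have hcc : 0 < c' ^ 2 - c ^ 2 := by nlinarith
  -- The threshold is what `(K ^ 2 + T) * c ^ 2 ≤ T * c' ^ 2` demands. All larger `T` are allowed,
  -- so that one metric can serve both bundles.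
  refine ⟨K ^ 2 * c ^ 2 / (c' ^ 2 - c ^ 2), fun T hT hT₀ p w hw => ?_⟩
  rw [div_le_iff₀ hcc] at hT₀
  refine le_of_sq_le_sq ?_ (mul_nonneg (hc0.trans hc).le (SmoothMetric.length_nonneg _ _ _))
  rw [mul_pow, SmoothMetric.sq_length_addPullback, SmoothMetric.sq_length_addPullback]
  have h1 : gM.length (f p) (mfderiv (𝓡 m) (𝓡 m) f p w) ≤
      K * gB.length (fbar (π p)) (mfderiv (𝓡 b) (𝓡 b) fbar (π p)
        (mfderiv (𝓡 m) (𝓡 b) π p w)) := hbd p w hw 1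
  have h2 := h.contract (π p) _ hw.1
  have h3 : gB.length (π (f p)) (mfderiv (𝓡 m) (𝓡 b) π (f p) (mfderiv (𝓡 m) (𝓡 m) f p w)) =
      gB.length (fbar (π p)) (mfderiv (𝓡 b) (𝓡 b) fbar (π p) (mfderiv (𝓡 m) (𝓡 b) π p w)) :=
    congrArg (fun w : TangentBundle (𝓡 b) B => gB.length w.1 w.2) (h.tangentMap_cover ⟨p, w⟩)
  rw [h3]
  set X := gB.length (fbar (π p)) (mfderiv (𝓡 b) (𝓡 b) fbar (π p) (mfderiv (𝓡 m) (𝓡 b) π p w))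
  set Y := gB.length (π p) (mfderiv (𝓡 m) (𝓡 b) π p w)
  have hX : 0 ≤ X := gB.length_nonneg _ _
  have h4 : gM.length (f p) (mfderiv (𝓡 m) (𝓡 m) f p w) ^ 2 ≤ K ^ 2 * X ^ 2 := by
    rw [← mul_pow]; exact pow_le_pow_left₀ (gM.length_nonneg _ _) h1 2
  have h5 : X ^ 2 ≤ c ^ 2 * Y ^ 2 := by rw [← mul_pow]; exact pow_le_pow_left₀ hX h2 2
  calc gM.length (f p) (mfderiv (𝓡 m) (𝓡 m) f p w) ^ 2 + T * X ^ 2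
      ≤ (K ^ 2 + T) * X ^ 2 := by linarith
    _ ≤ (K ^ 2 + T) * (c ^ 2 * Y ^ 2) := mul_le_mul_of_nonneg_left h5 (by positivity)
    _ = (K ^ 2 * c ^ 2 + T * c ^ 2) * Y ^ 2 := by ring
    _ ≤ (T * c' ^ 2) * Y ^ 2 := mul_le_mul_of_nonneg_right (by linarith) (sq_nonneg Y)
    _ = c' ^ 2 * (0 + T * Y ^ 2) := by ring
    _ ≤ c' ^ 2 * (gM.length p w ^ 2 + T * Y ^ 2) := by gcongr; positivity

end Metric
end

/-! ### Assembly of the splitting and the metric -/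

noncomputable section
open Filter Set

section Main

variable {m b : ℕ}
  {M : Type*} [TopologicalSpace M] [ChartedSpace (EuclideanSpace ℝ (Fin m)) M]
  {B : Type*} [TopologicalSpace B] [ChartedSpace (EuclideanSpace ℝ (Fin b)) B]

theorem isDInvariant_verticalField {π : M → B} (hπ : ContMDiff (𝓡 m) (𝓡 b) 1 π)
    {f : M ≃ₘ^∞⟮𝓡 m, 𝓡 m⟯ M} {fbar : B ≃ₘ^1⟮𝓡 b, 𝓡 b⟯ B} (hcover : ∀ p, π (f p) = fbar (π p)) :
    IsDInvariant f (verticalField (m := m) (b := b) π) := by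
  rw [isDInvariant_iff (by simp)]
  intro w
  have h1 : ∀ w : TangentBundle (𝓡 m) M, w.2 ∈ verticalField (m := m) (b := b) π w.1 ↔
      (tangentMap (𝓡 m) (𝓡 b) π w).2 = 0 := fun w => LinearMap.mem_ker
  rw [h1, h1, tangentMap_semiconj hπ hcover]
  exact map_eq_zero_iff _ (diffeomorph_mfderiv_injective le_rfl fbar _)

variable [IsManifold (𝓡 m) ∞ M] [IsManifold (𝓡 b) ∞ B]

/-- An invariant continuous subbundle that has a uniformly contracted complement is nonzero. -/
theorem ne_bot_of_isCompl_contracted [CompactSpace B] [T2Space B] [PreconnectedSpace B]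
    (hb : 0 < b) (g : SmoothMetric b B) {h : B → B} (hh : ContMDiff (𝓡 b) (𝓡 b) 1 h)
    (hsurj : Function.Surjective h) {E E' : PlaneField b B} (hE : IsContinuousSubbundle E)
    (hcompl : ∀ x, IsCompl (E x) (E' x)) {c : ℝ} (hc0 : 0 < c) (hc1 : c < 1)
    (hc : ∀ x, ∀ v ∈ E' x, g.length (h x) (mfderiv (𝓡 b) (𝓡 b) h x v) ≤ c * g.length x v) (x : B) :
    E x ≠ ⊥ := by
  intro hx
  have : Nonempty B := ⟨x⟩
  have hbot : ∀ y, E y = ⊥ := fun y =>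
    (hE.isLocallyConstant_eq_bot.apply_eq_of_preconnectedSpace x y).mp hx
  refine not_uniform_contraction hb g hh hsurj hc0 hc1 fun y v => hc y v ?_
  have h1 := (hcompl y).sup_eq_top
  rw [hbot, bot_sup_eq] at h1
  rw [h1]
  exact Submodule.mem_top

end Main
end

theorem mainTheorem6
    {m b d : ℕ} (hb : 0 < b) (hd : 0 < d)
    {M : Type*} [TopologicalSpace M] [T2Space M] [CompactSpace M] [ConnectedSpace M]
    [ChartedSpace (EuclideanSpace ℝ (Fin m)) M] [IsManifold (𝓡 m) ∞ M]
    {B : Type*} [TopologicalSpace B] [T2Space B] [CompactSpace B]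
    [ChartedSpace (EuclideanSpace ℝ (Fin b)) B] [IsManifold (𝓡 b) ∞ B]
    {F : Type*} [TopologicalSpace F] [T2Space F] [CompactSpace F]
    [ChartedSpace (EuclideanSpace ℝ (Fin d)) F] [IsManifold (𝓡 d) ∞ F]
    (π : M → B) (hπ : IsSmoothFiberBundle (m := m) (b := b) d F π)
    (f : M ≃ₘ^∞⟮𝓡 m, 𝓡 m⟯ M) (fbar : B ≃ₘ^1⟮𝓡 b, 𝓡 b⟯ B)
    (hcover : ∀ p, π (f p) = fbar (π p))
    (l : ℝ) (hl : 1 < l)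
    (gM : SmoothMetric m M) (hdist : fiberDistortion (b := b) gM π f < ENNReal.ofReal l)
    (EsB EuB : PlaneField b B) (hAnosov : IsAnosovSplitting fbar EsB EuB)
    (gB : SmoothMetric b B)
    (hs : ∀ x, normOn gB fbar EsB x < ENNReal.ofReal l⁻¹)
    (hu : ∀ x, ENNReal.ofReal l < conormOn gB fbar EuB x) :
    ∃ Es Eu : PlaneField m M,
      IsPartiallyHyperbolicSplitting f Es (verticalField (b := b) π) Eu ∧
      ∃ g : SmoothMetric m M,
        PartiallyHyperbolicBounds g f Es (verticalField (b := b) π) Eu l⁻¹ l := by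
  have hl0 : 0 < l := zero_lt_one.trans hl
  have hl1 : l⁻¹ < 1 := inv_lt_one_of_one_lt₀ hl
  have hinv0 : 0 < l⁻¹ := inv_pos.2 hl0
  have hπs := hπ.contMDiff
  have hπ1 : ContMDiff (𝓡 m) (𝓡 b) 1 π := hπs.of_le (by exact_mod_cast le_top)
  have hsurj := hπ.surjective_mfderiv
  have : ConnectedSpace B := hπ.surjective.connectedSpace hπ1.continuous
  have hcover' : ∀ p, π (f.symm p) = fbar.symm (π p) := fun p => by
    rw [← fbar.symm_apply_apply (π (f.symm p)), ← hcover, f.apply_symm_apply]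
  set V := verticalField (m := m) (b := b) π
  have hVinv : IsDInvariant f V := isDInvariant_verticalField hπ1 hcover
  have hVinv' : IsDInvariant f.symm V := hVinv.symm (by simp)
  -- bounds along the fibers
  obtain ⟨δ, hδ1, hδl, hVf, hVf'⟩ : ∃ δ : ℝ, 1 ≤ δ ∧ δ < l ∧
      (∀ p, ∀ w ∈ V p, gM.length (f p) (mfderiv (𝓡 m) (𝓡 m) f p w) ≤ δ * gM.length p w) ∧
      ∀ p, ∀ w ∈ V p,
        gM.length (f.symm p) (mfderiv (𝓡 m) (𝓡 m) f.symm p w) ≤ δ * gM.length p w := by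
    set D := fiberDistortion (b := b) gM π f with hD
    have hDtop : D ≠ ⊤ := hdist.ne_top
    have hDle : D ≤ ENNReal.ofReal (max D.toReal 1) := by
      rw [← ENNReal.ofReal_toReal hDtop]
      exact ENNReal.ofReal_le_ofReal (by simp)
    have h0 : (0 : ℝ) ≤ max D.toReal 1 := le_max_of_le_right zero_le_one
    have hp : ∀ p, max (normOn gM f V p) (normOn gM f.symm V p) ≤ D := fun p =>
      le_iSup (fun p => max (normOn gM f V p) (normOn gM f.symm V p)) p
    -- The maximum with `1` makes `δ` positive, hence invertible, and stays below `l` because `1 <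
    -- l`.
    refine ⟨max D.toReal 1, le_max_right _ _, max_lt ?_ hl, fun p w hw => ?_, fun p w hw => ?_⟩
    · exact (ENNReal.lt_ofReal_iff_toReal_lt hDtop).1 hdist
    · exact length_le_of_normOn_le h0 (((le_max_left _ _).trans (hp p)).trans hDle) hw
    · exact length_le_of_normOn_le h0 (((le_max_right _ _).trans (hp p)).trans hDle) hw
  have hδ0 : 0 < δ := zero_lt_one.trans_le hδ1
  have hVge : ∀ p, ∀ w ∈ V p, gM.length p w ≤ δ * gM.length (f p) (mfderiv (𝓡 m) (𝓡 m) f p w) :=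
    fun p w hw => le_length_of_symm_le (by simp) hVinv hVf' hw
  have hVge' : ∀ p, ∀ w ∈ V p,
      gM.length p w ≤ δ * gM.length (f.symm p) (mfderiv (𝓡 m) (𝓡 m) f.symm p w) :=
    fun p w hw => le_length_of_symm_le (f := f.symm) (by simp) hVinv' hVf hw
  have hmul : ∀ c, 0 < c → c < l⁻¹ → δ * c < 1 := fun c hc0 hc =>
    (mul_lt_mul'' hδl hc hδ0.le hc0.le).trans_eq (mul_inv_cancel₀ hl0.ne')
  have hEuinv : IsDInvariant fbar.symm EuB := hAnosov.invariant_u.symm le_rfl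
  obtain ⟨cs, hcs0, hcsl, hcs⟩ := exists_uniform_contraction gB hAnosov.continuous_s
    fbar.contMDiff hinv0 fun x v hv hv0 => length_lt_of_normOn_lt (hs x) hv hv0
  obtain ⟨cu, hcu0, hcul, hcu⟩ := exists_uniform_contraction gB hAnosov.continuous_u
    fbar.symm.contMDiff hinv0 fun x v hv hv0 => by
      have h1 := ((isDInvariant_iff le_rfl).1 hEuinv ⟨x, v⟩).2 hv
      have h2 : mfderiv (𝓡 b) (𝓡 b) fbar.symm x v ≠ 0 :=
        (map_ne_zero_iff _ (diffeomorph_mfderiv_injective le_rfl fbar.symm x)).2 hv0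
      have h3 := lt_length_of_lt_conormOn hl0.le (hu (fbar.symm x)) h1 h2
      have h4 := congrArg (fun w : TangentBundle (𝓡 b) B => gB.length w.1 w.2)
        (diffeomorph_tangentMap_apply_symm le_rfl fbar ⟨x, v⟩)
      rw [lt_inv_mul_iff₀ hl0]
      exact h3.trans_eq h4
  have Hs : IsDominatedLift gM gB π f fbar EsB δ cs :=
    ⟨hπ1, hsurj, hcover, hAnosov.continuous_s, hAnosov.invariant_s, hδ0.le, hcs0, hmul _ hcs0 hcsl,
      hVge, hcs⟩
  -- Time reversal: the distortion bounds `f` and `f.symm` alike, so the unstable bundle of `f` is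
  -- the contracting field of `f.symm`.
  have Hu : IsDominatedLift gM gB π f.symm fbar.symm EuB δ cu :=
    ⟨hπ1, hsurj, hcover', hAnosov.continuous_u, hEuinv, hδ0.le, hcu0, hmul _ hcu0 hcul,
      hVge', hcu⟩
  obtain ⟨Ks, -, hliftS, -⟩ := Hs.exists_contractingField_bound
  obtain ⟨Ku, -, hliftU, -⟩ := Hu.exists_contractingField_bound
  set Es := contractingField gM π f EsB cs
  set Eu := contractingField gM π f.symm EuB cu
  have hEuinvM : IsDInvariant f Eu := Hu.isDInvariant_contractingField.symm (by simp)
  -- If `EsB` vanished, `EuB` would be all of `TB` and `fbar.symm` would contract `B`.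
  have hEsB : ∀ x, EsB x ≠ ⊥ := ne_bot_of_isCompl_contracted hb gB fbar.symm.contMDiff
    fbar.symm.surjective hAnosov.continuous_s hAnosov.isCompl hcu0 (hcul.trans hl1) hcu
  have hEuB : ∀ x, EuB x ≠ ⊥ := ne_bot_of_isCompl_contracted hb gB fbar.contMDiff
    fbar.surjective hAnosov.continuous_u (fun x => (hAnosov.isCompl x).symm) hcs0
    (hcsl.trans hl1) hcs
  have hne : ∀ {E : PlaneField m M} {E' : PlaneField b B} (p : M), E' (π p) ≠ ⊥ →
      (∀ p, ∀ v ∈ E' (π p), ∃ w ∈ E p, mfderiv (𝓡 m) (𝓡 b) π p w = v) → E p ≠ ⊥ := by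
    intro E E' p hE' hlift
    obtain ⟨v, hv, hv0⟩ := (Submodule.ne_bot_iff _).1 hE'
    obtain ⟨w, hw, hwv⟩ := hlift p v hv
    refine (Submodule.ne_bot_iff _).2 ⟨w, hw, ?_⟩
    rintro rfl
    exact hv0 (hwv.symm.trans (map_zero _))
  have hVne : ∀ p, V p ≠ ⊥ := hπ.verticalField_ne_bot hd
  -- the metric
  obtain ⟨cs', hcs', hcsl'⟩ := exists_between hcsl
  obtain ⟨cu', hcu', hcul'⟩ := exists_between hcul
  obtain ⟨Ts, hTs⟩ := Hs.exists_length_addPullback_le hπs hcs'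
  obtain ⟨Tu, hTu⟩ := Hu.exists_length_addPullback_le hπs hcu'
  have hT : 0 ≤ max 0 (max Ts Tu) := le_max_left _ _
  replace hTs := hTs _ hT ((le_max_left _ _).trans (le_max_right _ _))
  replace hTu := hTu _ hT ((le_max_right _ _).trans (le_max_right _ _))
  set g := gM.addPullback gB hπs hT
  have hcu0' : 0 < cu' := hcu0.trans hcu'
  have hgV : ∀ p, ∀ w ∈ V p, g.length p w = gM.length p w := fun p w hw =>
    SmoothMetric.length_addPullback_of_vertical gM gB hπs hT hw
  have hVmem : ∀ p, ∀ w ∈ V p, mfderiv (𝓡 m) (𝓡 m) f p w ∈ V (f p) := fun p w hw =>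
    ((isDInvariant_iff (by simp)).1 hVinv ⟨p, w⟩).2 hw
  have hbounds : PartiallyHyperbolicBounds g f Es V Eu l⁻¹ l := by
    intro p
    refine ⟨?_, ?_, conormOn_le_normOn (hVne p), ?_, ?_⟩
    · exact (normOn_le_ofReal (hTs p)).trans_lt ((ENNReal.ofReal_lt_ofReal_iff hinv0).2 hcsl')
    · refine lt_of_lt_of_le ((ENNReal.ofReal_lt_ofReal_iff (inv_pos.2 hδ0)).2
        (inv_strictAnti₀ hδ0 hδl)) (ofReal_le_conormOn fun w hw => ?_)
      rw [hgV p w hw, hgV _ _ (hVmem p w hw), inv_mul_le_iff₀ hδ0]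
      exact hVge p w hw
    · refine (normOn_le_ofReal (a := δ) fun w hw => ?_).trans_lt
        ((ENNReal.ofReal_lt_ofReal_iff hl0).2 hδl)
      rw [hgV p w hw, hgV _ _ (hVmem p w hw)]
      exact hVf p w hw
    · refine lt_of_lt_of_le ((ENNReal.ofReal_lt_ofReal_iff (inv_pos.2 hcu0')).2
        ((lt_inv_comm₀ hcu0' hl0).1 hcul')) (ofReal_le_conormOn fun w hw => ?_)
      rw [inv_mul_le_iff₀ hcu0']
      exact le_length_of_symm_le (by simp) hEuinvM hTu hw
  refine ⟨Es, Eu, ⟨by simp, Hs.isContinuousSubbundle_contractingField,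
    isContinuousSubbundle_verticalField hπ1 hsurj, Hu.isContinuousSubbundle_contractingField,
    fun p => ⟨hne p (hEsB _) hliftS, hVne p, hne p (hEuB _) hliftU⟩, fun p => ?_,
    Hs.isDInvariant_contractingField, hVinv, hEuinvM,
    ⟨g, l⁻¹, l, hinv0, hl1, hl, hbounds⟩⟩, g, hbounds⟩
  exact isInternal_of_isCompl (mfderiv (𝓡 m) (𝓡 b) π p).toLinearMap (hAnosov.isCompl (π p))
    (fun v hv => hv.1) (fun v hv => hv.1)
    (fun v hv => Hs.eq_zero_of_mem_contractingField hv)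
    (fun v hv => Hu.eq_zero_of_mem_contractingField hv) (hliftS p) (hliftU p)
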